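/- Let $(\mathcal A,\varphi,\varphi_2)$ be a second order probability space: $\mathcal A$ is a unital complex algebra, $\varphi$ is a tracial linear functional with $\varphi(1)=1$, and $\varphi_2$ is a symmetric bilinear form on $\mathcal A$, tracial in each variable, with $\varphi_2(1,a)=\varphi_2(a,1)=0$ for all $a$. *Permutations.* For a permutation $\pi$ of $N$ points let $\#(\pi)$ be its number of cycles and $|\pi|=N-\#(\pi)$. Let $\gamma_n=(1,\dots,n)$ and $\gamma_{m,n}=(1,\dots,m)(m+1,\dots,m+n)$. Let $NC(n)$ be the set of non-crossing partitions of $[n]$, regarded as permutations (each block is a cycle in increasing order), that is, the permutations $\pi$ with $|\pi|+|\pi^{-1}\gamma_n|=|\gamma_n|$. Let $S_{NC}(m,n)$ be the set of permutations $\pi$ of $[m+n]$ such that some cycle of $\pi$ meets both cycles of $\gamma_{m,n}$ and $|\pi|+|\pi^{-1}\gamma_{m,n}|=|\gamma_{m,n}|+2$. Write $\mathrm{Kr}(\pi)=\pi^{-1}\gamma_{m,n}$. A permutation $\pi$ is $k$-alternating if $\pi(i)\equiv i+1 \pmod k$ for all $i$, and $k$-equal if all its cycles have exactly $k$ elements.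 *Cumulants.* The free cumulants $\kappa_n$ are defined recursively by $\varphi(x_1\cdots x_n)=\sum_{\pi\in NC(n)}\kappa_\pi(x_1,\dots,x_n)$, where for a permutation $\pi$ we put $\kappa_\pi(x_1,\dots,x_n)=\prod \kappa_l(x_{i_1},\dots,x_{i_l})$, the product over the cycles $(i_1,\dots,i_l)$ of $\pi$ (with $i_1$ the smallest element of its cycle). The second order cumulants $\kappa_{m,n}$, $m,n\ge 1$, are defined recursively by $$\varphi_2(x_1\cdots x_m,\,x_{m+1}\cdots x_{m+n})=\sum_{\pi\in S_{NC}(m,n)}\kappa_\pi(x_1,\dots,x_{m+n})+\sum_{(\mathcal U,\pi)}\kappa_{(\mathcal U,\pi)}(x_1,\dots,x_{m+n}),$$ where in the last sum $\pi=\pi_1\times\pi_2$ with $\pi_1$ a non-crossing partition of $\{1,\dots,m\}$ and $\pi_2$ one of $\{m+1,\dots,m+n\}$, $\mathcal U$ is obtained by joining one cycle of $\pi_1$ with one cycle of $\pi_2$, and $\kappa_{(\mathcal U,\pi)}$ is the product of the second order cumulant of the two joined cycles with the free cumulants of all other cycles. Elements $a_1,\dots,a_k$ are second order free if, for the unital subalgebras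 $\mathcal A_i$ generated by $a_i$, all cumulants $\kappa_n$ and $\kappa_{m,n}$ with entries in $\bigcup_i\mathcal A_i$ that are mixed (two entries are taken from subalgebras with different indices) vanish. **Theorem.** Let $k\ge 1$, let $a_1,\dots,a_k\in\mathcal A$ be second order free with $\kappa_{p,q}(a_i,\dots,a_i)=0$ for all $p,q\ge1$ and all $i$, and let $a=a_1a_2\cdots a_k$. Then for all $p,q\ge 1$, $$\varphi_2(a^p,a^q)=\sum_{\substack{\pi\in S_{NC}(kp,kq)\\ \pi\ k\text{-alternating}}}\kappa_{\mathrm{Kr}(\pi)}(a_1,\dots,a_k,\dots,a_1,\dots,a_k)$$ and $$\kappa_{p,q}(a,\dots,a)=\sum_{\substack{\pi\in S_{NC}(kp,kq)\\ \pi\ k\text{-alternating and }k\text{-equal}}}\kappa_{\mathrm{Kr}(\pi)}(a_1,\dots,a_k,\dots,a_1,\dots,a_k),$$ where the sequence $a_1,\dots,a_k$ is repeated $p+q$ times. -/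

import Mathlib

open scoped BigOperators

namespace SecondOrder

/-- A second order (tracial) non-commutative probability space structure on a unital complex
algebra: a normalized trace `phi` and a symmetric bilinear form `phi2`, tracial in each variable,
which vanishes when one of its arguments is `1`. -/
structure ProbSpace (A : Type*) [Ring A] [Algebra ℂ A] where
  phi : A →ₗ[ℂ] ℂ
  phi2 : A →ₗ[ℂ] A →ₗ[ℂ] ℂ
  phi_one : phi 1 = 1
  phi_tracial : ∀ a b, phi (a * b) = phi (b * a)
  phi2_symm : ∀ a b, phi2 a b = phi2 b a
  phi2_tracial_left : ∀ a b c, phi2 (a * b) c = phi2 (b * a) c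
  phi2_tracial_right : ∀ a b c, phi2 c (a * b) = phi2 c (b * a)
  phi2_one_left : ∀ a, phi2 1 a = 0
  phi2_one_right : ∀ a, phi2 a 1 = 0

/-! ### Permutations of `{0, …, n - 1}` -/

/-- `#(π)`: the number of cycles of `π`, fixed points included. -/
noncomputable def numCycles {n : ℕ} (π : Equiv.Perm (Fin n)) : ℕ :=
  Nat.card (Quotient (Equiv.Perm.SameCycle.setoid π))

/-- The length `|π| = n - #(π)`; there is no truncation, as `#(π) ≤ n`. -/
noncomputable def length {n : ℕ} (π : Equiv.Perm (Fin n)) : ℕ := n - numCycles π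

/-- The size of the cycle of `π` that contains `i` (it is `1` for a fixed point). -/
noncomputable def cycleSize {n : ℕ} (π : Equiv.Perm (Fin n)) (i : Fin n) : ℕ :=
  Function.minimalPeriod (⇑π) i

/-- The smallest elements of the cycles of `π`: each cycle of `π`, fixed points included, contains
exactly one element of this set. -/
noncomputable def cycleReps {n : ℕ} (π : Equiv.Perm (Fin n)) : Finset (Fin n) :=
  Finset.univ.filter fun i => ∀ j, π.SameCycle i j → i ≤ j

/-- The entries `x_i, x_{π(i)}, x_{π²(i)}, …` of `x` along the cycle of `π` that contains `i`. -/
noncomputable def alongCycle {n : ℕ} {A : Type*} (π : Equiv.Perm (Fin n)) (x : Fin n → A) (i : Fin n) :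
    Fin (cycleSize π i) → A :=
  fun j => x ((π ^ (j : ℕ)) i)

open Classical in
/-- `NC(n)`: the non-crossing partitions of `n` points, each block being written as a cycle with
its elements in increasing order. As permutations they are those on a geodesic from the identity to
the full cycle `γ_n = (1, 2, …, n)`, that is, `|π| + |π⁻¹ γ_n| = |γ_n|`. -/
noncomputable def NC (n : ℕ) : Finset (Equiv.Perm (Fin n)) :=
  Finset.univ.filter fun π => length π + length (π⁻¹ * finRotate n) = length (finRotate n)

/-- `γ_{m,n}`: the permutation with the two cycles `(1, …, m)` and `(m + 1, …, m + n)`. -/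
def annulusPerm (m n : ℕ) : Equiv.Perm (Fin (m + n)) :=
  finSumFinEquiv.permCongr (Equiv.sumCongr (finRotate m) (finRotate n))

/-- The Kreweras complement `Kr(π) = π⁻¹ γ_{m,n}`. -/
def Kr {m n : ℕ} (π : Equiv.Perm (Fin (m + n))) : Equiv.Perm (Fin (m + n)) :=
  π⁻¹ * annulusPerm m n

open Classical in
/-- `S_NC(m, n)`: the non-crossing annular permutations. Some cycle meets both circles, and
`|π| + |π⁻¹ γ_{m,n}| = |γ_{m,n}| + 2`. -/
noncomputable def SNC (m n : ℕ) : Finset (Equiv.Perm (Fin (m + n))) :=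
  Finset.univ.filter fun π =>
    (∃ (i : Fin m) (j : Fin n), π.SameCycle (Fin.castAdd n i) (Fin.natAdd m j)) ∧
      length π + length (Kr π) = length (annulusPerm m n) + 2

open Classical in
/-- `PS_NC(m, n)'`: the partitioned permutations `(U, π)` with `π = π₁ × π₂ ∈ NC(m) × NC(n)` and
`U` the partition that joins one cycle of `π₁` to one cycle of `π₂` and whose other blocks are the
other cycles of `π₁` and `π₂`. Such a pair is stored as `((π₁, π₂), (i, j))`, where `i` and `j` are
the smallest elements of the two cycles that are joined. -/
noncomputable def PSNC' (m n : ℕ) :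
    Finset ((Equiv.Perm (Fin m) × Equiv.Perm (Fin n)) × (Fin m × Fin n)) :=
  Finset.univ.filter fun t =>
    t.1.1 ∈ NC m ∧ t.1.2 ∈ NC n ∧ t.2.1 ∈ cycleReps t.1.1 ∧ t.2.2 ∈ cycleReps t.1.2

/-! ### Facts that make the recursions below terminate -/

lemma cycleSize_le {n : ℕ} (π : Equiv.Perm (Fin n)) (i : Fin n) : cycleSize π i ≤ n := by
  have h : Function.Injective
      (fun j : Fin (cycleSize π i) => (⇑π)^[(j : ℕ)] i) := by
    intro a b hab
    exact Fin.ext (Function.iterate_injOn_Iio_minimalPeriod a.2 b.2 hab)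
  simpa using Fintype.card_le_of_injective _ h

lemma sameCycle_of_cycleSize_eq {n : ℕ} {π : Equiv.Perm (Fin n)} {i : Fin n}
    (hi : cycleSize π i = n) (j : Fin n) : π.SameCycle i j := by
  have h : Function.Injective
      (fun j : Fin (cycleSize π i) => (⇑π)^[(j : ℕ)] i) := by
    intro a b hab
    exact Fin.ext (Function.iterate_injOn_Iio_minimalPeriod a.2 b.2 hab)
  have hb := (Fintype.bijective_iff_injective_and_card _).2 ⟨h, by simp [hi]⟩
  obtain ⟨r, hr⟩ := hb.2 j
  refine ⟨(r : ℕ), ?_⟩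
  rw [← hr]
  simp [Equiv.Perm.iterate_eq_pow]

lemma cycleSize_lt {n : ℕ} {π : Equiv.Perm (Fin n)} (hπ : π ∈ NC n) (hne : π ≠ finRotate n)
    (i : Fin n) : cycleSize π i < n := by
  refine lt_of_le_of_ne (cycleSize_le π i) fun hi => hne ?_
  have hsub : Subsingleton (Quotient (Equiv.Perm.SameCycle.setoid π)) := by
    refine ⟨fun a b => ?_⟩
    induction a using Quotient.inductionOn
    induction b using Quotient.inductionOn
    exact Quotient.sound
      ((sameCycle_of_cycleSize_eq hi _).symm.trans (sameCycle_of_cycleSize_eq hi _))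
  have h1 : numCycles π ≤ 1 := Finite.card_le_one_iff_subsingleton.2 hsub
  have h2 : 1 ≤ numCycles (finRotate n) := by
    have : Nonempty (Quotient (Equiv.Perm.SameCycle.setoid (finRotate n))) := ⟨Quotient.mk _ i⟩
    exact Nat.card_pos
  have h3 := (Finset.mem_filter.1 hπ).2
  have hn : 0 < n := i.pos
  set τ := π⁻¹ * finRotate n with hτ
  have h4 : n ≤ numCycles τ := by
    unfold length at h3
    omega
  have hinj : Function.Injective (Quotient.mk (Equiv.Perm.SameCycle.setoid τ)) := by
    have hs : Function.Surjective (Quotient.mk (Equiv.Perm.SameCycle.setoid τ)) :=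
      Quotient.mk_surjective
    have h5 : numCycles τ ≤ n := by
      simpa [numCycles] using Nat.card_le_card_of_surjective _ hs
    have h6 : Nat.card (Fin n) = Nat.card (Quotient (Equiv.Perm.SameCycle.setoid τ)) := by
      simpa [numCycles] using le_antisymm h4 h5
    exact ((Nat.bijective_iff_surjective_and_card _).2 ⟨hs, h6⟩).1
  have h7 : τ = 1 := by
    ext x
    have : τ x = x := hinj (Quotient.sound (Equiv.Perm.sameCycle_apply_left.2 (by rfl)))
    simp [this]
  rw [hτ, inv_mul_eq_one] at h7
  exact h7

/-! ### Cumulants -/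

variable {A : Type*} [Ring A] [Algebra ℂ A]

open Classical in
/-- The free cumulants `κ_n(x₁, …, x_n)`, defined recursively by the moment-cumulant formula
`φ(x₁ ⋯ x_n) = ∑_{π ∈ NC(n)} ∏_{cycles V of π} κ_{|V|}(x|V)` solved for the term of `π = γ_n`. -/
noncomputable def cumulant (S : ProbSpace A) (n : ℕ) (x : Fin n → A) : ℂ :=
  S.phi (List.ofFn x).prod -
    ∑ π ∈ ((NC n).erase (finRotate n)).attach,
      ∏ i ∈ cycleReps π.1, cumulant S (cycleSize π.1 i) (alongCycle π.1 x i)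
termination_by n
decreasing_by
  exact cycleSize_lt (Finset.mem_of_mem_erase π.2) (Finset.ne_of_mem_erase π.2) i

/-- `κ_π(x₁, …, x_n) = ∏ κ_l(x_{i₁}, …, x_{i_l})`, the product over the cycles
`(i₁, …, i_l)` of `π`. -/
noncomputable def permCumulant (S : ProbSpace A) {n : ℕ} (π : Equiv.Perm (Fin n))
    (x : Fin n → A) : ℂ :=
  ∏ i ∈ cycleReps π, cumulant S (cycleSize π i) (alongCycle π x i)

lemma add_cycleSize_lt {m n : ℕ}
    {t : (Equiv.Perm (Fin m) × Equiv.Perm (Fin n)) × (Fin m × Fin n)}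
    (ht : t ∈ PSNC' m n) (hne : t.1 ≠ (finRotate m, finRotate n)) :
    cycleSize t.1.1 t.2.1 + cycleSize t.1.2 t.2.2 < m + n := by
  obtain ⟨h1, h2, -, -⟩ := (Finset.mem_filter.1 ht).2
  have l1 := cycleSize_le t.1.1 t.2.1
  have l2 := cycleSize_le t.1.2 t.2.2
  by_cases e1 : t.1.1 = finRotate m
  · have e2 : t.1.2 ≠ finRotate n := fun e2 => hne (Prod.ext e1 e2)
    have := cycleSize_lt h2 e2 t.2.2
    omega
  · have := cycleSize_lt h1 e1 t.2.1
    omega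

open Classical in
/-- The second order cumulants `κ_{m,n}(x₁, …, x_m, y₁, …, y_n)`, defined recursively by the
second order moment-cumulant formula
`φ₂(x₁ ⋯ x_m, y₁ ⋯ y_n) = ∑_{π ∈ S_NC(m,n)} κ_π + ∑_{(U,π) ∈ PS_NC(m,n)'} κ_{(U,π)}`
solved for the term of `(U, π) = (1_{m+n}, γ_{m,n})`. Here `κ_{(U,π)}` is the product of `κ_{r,s}`
of the two joined cycles with the free cumulants of all the other cycles. -/
noncomputable def cumulant₂ (S : ProbSpace A) (m n : ℕ) (x : Fin m → A) (y : Fin n → A) : ℂ :=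
  S.phi2 (List.ofFn x).prod (List.ofFn y).prod -
    ∑ π ∈ SNC m n, permCumulant S π (Fin.append x y) -
    ∑ t ∈ ((PSNC' m n).filter fun t => t.1 ≠ (finRotate m, finRotate n)).attach,
      cumulant₂ S (cycleSize t.1.1.1 t.1.2.1) (cycleSize t.1.1.2 t.1.2.2)
          (alongCycle t.1.1.1 x t.1.2.1) (alongCycle t.1.1.2 y t.1.2.2) *
        (∏ i ∈ (cycleReps t.1.1.1).erase t.1.2.1,
          cumulant S (cycleSize t.1.1.1 i) (alongCycle t.1.1.1 x i)) *
        (∏ j ∈ (cycleReps t.1.1.2).erase t.1.2.2,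
          cumulant S (cycleSize t.1.1.2 j) (alongCycle t.1.1.2 y j))
termination_by m + n
decreasing_by
  exact add_cycleSize_lt (Finset.mem_filter.1 t.2).1 (Finset.mem_filter.1 t.2).2

/-- Subalgebras are second order free if all mixed first and second order cumulants vanish. A
cumulant is mixed if two of its entries are taken from subalgebras with different indices. -/
def SecondOrderFree (S : ProbSpace A) {ι : Type*} (B : ι → Subalgebra ℂ A) : Prop :=
  (∀ (n : ℕ) (x : Fin n → A) (c : Fin n → ι),
    (∀ i, x i ∈ B (c i)) → (∃ r s, c r ≠ c s) → cumulant S n x = 0) ∧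
  (∀ (m n : ℕ) (x : Fin m → A) (y : Fin n → A) (c : Fin m ⊕ Fin n → ι),
    0 < m → 0 < n → (∀ i, Sum.elim x y i ∈ B (c i)) → (∃ r s, c r ≠ c s) →
      cumulant₂ S m n x y = 0)

/-- Elements are second order free if the unital subalgebras that they generate are. -/
def ElementsSecondOrderFree (S : ProbSpace A) {ι : Type*} (a : ι → A) : Prop :=
  SecondOrderFree S fun i => Algebra.adjoin ℂ {a i}

/-! ### Classes of annular permutations -/

/-- `π` is `k`-alternating: `π(i) ≡ i + 1 (mod k)`. -/
def IsAlternating (k : ℕ) {N : ℕ} (π : Equiv.Perm (Fin N)) : Prop :=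
  ∀ i, ((π i : Fin N) : ℕ) ≡ (i : ℕ) + 1 [MOD k]

/-- `π` is `k`-equal: every cycle has size `k`. -/
def IsEqual (k : ℕ) {N : ℕ} (π : Equiv.Perm (Fin N)) : Prop :=
  ∀ i, cycleSize π i = k

/-- The periodic sequence `a₁, …, a_k, a₁, …, a_k, …`, cut off after `N` entries. -/
def periodic {k : ℕ} (hk : 0 < k) (a : Fin k → A) (N : ℕ) : Fin N → A :=
  fun i => a ⟨(i : ℕ) % k, Nat.mod_lt _ hk⟩

end SecondOrder

namespace SecondOrder

open Equiv

/-! The moment φ₂(a^p, a^q) is computed in the letters a_i and then compared with the recursion for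
the cumulants of a.

By freeness and the vanishing hypothesis, every second order cumulant with entries among the a_i is
zero (`cumulant₂_eq_zero`). So only the sum over S_NC(kp, kq) survives, and in it only permutations
that preserve residues modulo k. Such a permutation is a k-tuple τ of permutations of p + q points,
one for each residue. Sorted by residue, γ_{kp,kq} becomes a spiral through k copies of the p + q
points. Composed with the inverse of the tuple, its first-return map to copy 0 is γ u⁻¹, where γ =
γ_{p,q} and u is the ordered product of the tuple. Counting cycles turns the annular condition into
Σ|τ_r| + |u⁻¹γ| = |γ| + 2, with some τ_r crossing between the circles
(`permLength_blockPerm_spiral`, `blockPerm_mem_SNC_iff`).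

Now group the tuples by u (`ringFactorizations_eq`). The triangle inequality and parity leave two
cases: either τ is a minimal factorization of some u in S_NC(p, q), or u = v × w with v, w
non-crossing and Σ|τ_r| = |u| + 2. The genus inequality `exists_setoid_genus` controls both. The
factors of a minimal factorization stay inside the cycles of u, so the weights factor over these
cycles (`geodesicSum_eq_prod`). With excess 2 and a crossing factor, exactly one cycle of v is
joined with one of w, and everything else is minimal (`annularSum_eq_sum`).

This is the shape of the second order moment-cumulant formula for a, with sums over minimal
factorizations in place of κ_n(a, …, a) and annular sums in place of κ_{p,q}(a, …, a). The same
argument on one circle identifies the former (`geodesicSum_finRotate`), and induction on p + q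
identifies the latter (`annularSum_finRotate`).

Finally, π ↦ Kr(π) permutes S_NC. The permutations whose complement preserves residues are
k-alternating, and they are k-equal exactly when the return map is trivial, that is, when u = γ. -/

/-! ### Products over the cycles of a permutation -/

/-- A family of points that meets every cycle of `π` exactly once. -/
structure IsCycleTransversal {α ι : Type*} (π : Perm α) (f : ι → α) : Prop where
  inj : ∀ i j, π.SameCycle (f i) (f j) → i = j
  surj : ∀ x, ∃ i, π.SameCycle (f i) x

/-- `g` takes a single value on each cycle of `π`. -/
def CycleConstant {α β : Type*} (π : Perm α) (g : α → β) : Prop :=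
  ∀ x, g (π x) = g x

lemma CycleConstant.eq_of_sameCycle {α β : Type*} [Finite α] {π : Perm α} {g : α → β}
    (h : CycleConstant π g) {x y : α} (hxy : π.SameCycle x y) : g x = g y := by
  obtain ⟨n, rfl⟩ := hxy.exists_nat_pow_eq
  induction n with
  | zero => rfl
  | succ n ih =>
    rw [pow_succ', Perm.mul_apply, h]
    exact ih ⟨n, by simp⟩

/-- The product over the cycles of `π` of the value of `g` at some point of the cycle. -/
noncomputable def cycleProd {α M : Type*} [CommMonoid M] (π : Perm α) (g : α → M) : M :=
  ∏ᶠ q : Quotient (Perm.SameCycle.setoid π), g q.out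

lemma isCycleTransversal_out {α : Type*} (π : Perm α) :
    IsCycleTransversal π (Quotient.out : Quotient (Perm.SameCycle.setoid π) → α) where
  inj i j h := by
    have : Quotient.mk (Perm.SameCycle.setoid π) i.out = Quotient.mk _ j.out := Quotient.sound h
    simpa using this
  surj x := ⟨Quotient.mk _ x, Quotient.mk_out (s := Perm.SameCycle.setoid π) x⟩

lemma IsCycleTransversal.bijective {α ι : Type*} {π : Perm α} {f : ι → α}
    (hf : IsCycleTransversal π f) :
    Function.Bijective fun i => Quotient.mk (Perm.SameCycle.setoid π) (f i) := by
  refine ⟨fun i j h => hf.inj i j (Quotient.exact h), fun q => ?_⟩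
  obtain ⟨i, hi⟩ := hf.surj q.out
  exact ⟨i, (Quotient.sound hi).trans q.out_eq⟩

/-- The choice of representatives is irrelevant when `g` is constant on cycles. This permits the
smallest elements of the cycles, or transversals glued from pieces. -/
lemma cycleProd_eq {α ι M : Type*} [CommMonoid M] [Finite α] {π : Perm α} {f : ι → α} {g : α → M}
    (hf : IsCycleTransversal π f) (hg : CycleConstant π g) :
    cycleProd π g = ∏ᶠ i, g (f i) := by
  refine (finprod_eq_of_bijective _ hf.bijective fun i => ?_).symm
  exact hg.eq_of_sameCycle (Perm.SameCycle.symm (Quotient.mk_out (s := Perm.SameCycle.setoid π) (f i)))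

/-- The number of cycles of `π`, fixed points included. -/
noncomputable def cycleCount {α : Type*} (π : Perm α) : ℕ :=
  Nat.card (Quotient (Perm.SameCycle.setoid π))

/-- `|π|`: the number of points minus the number of cycles. -/
noncomputable def permLength {α : Type*} (π : Perm α) : ℕ := Nat.card α - cycleCount π

lemma numCycles_eq {n : ℕ} (π : Perm (Fin n)) : numCycles π = cycleCount π := rfl

lemma length_eq {n : ℕ} (π : Perm (Fin n)) : length π = permLength π := by
  simp [length, permLength, numCycles_eq]

lemma cycleCount_le {α : Type*} [Finite α] (π : Perm α) : cycleCount π ≤ Nat.card α :=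
  Nat.card_le_card_of_surjective _ (Quotient.mk_surjective (s := Perm.SameCycle.setoid π))

lemma permLength_add_cycleCount {α : Type*} [Finite α] (π : Perm α) :
    permLength π + cycleCount π = Nat.card α :=
  Nat.sub_add_cancel (cycleCount_le π)

lemma IsCycleTransversal.cycleCount_eq {α ι : Type*} {π : Perm α} {f : ι → α}
    (hf : IsCycleTransversal π f) : cycleCount π = Nat.card ι :=
  (Nat.card_congr (Equiv.ofBijective _ hf.bijective)).symm

lemma sameCycle_permCongr {α β : Type*} (e : α ≃ β) (π : Perm α) (x y : β) :
    (e.permCongr π).SameCycle x y ↔ π.SameCycle (e.symm x) (e.symm y) := by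
  have h : ∀ (n : ℤ) (z : β), (e.permCongr π ^ n) z = e ((π ^ n) (e.symm z)) := by
    intro n z
    have : e.permCongr π ^ n = e.permCongr (π ^ n) := by
      have := map_zpow e.permCongrHom π n
      exact this.symm
    rw [this]; rfl
  constructor
  · rintro ⟨n, hn⟩
    exact ⟨n, by rw [← hn, h]; simp⟩
  · rintro ⟨n, hn⟩
    exact ⟨n, by rw [h, hn]; simp⟩

lemma IsCycleTransversal.permCongr {α β ι : Type*} (e : α ≃ β) {π : Perm α} {f : ι → α}
    (hf : IsCycleTransversal π f) : IsCycleTransversal (e.permCongr π) (e ∘ f) where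
  inj i j h := hf.inj i j (by simpa [sameCycle_permCongr] using h)
  surj x := by
    obtain ⟨i, hi⟩ := hf.surj (e.symm x)
    exact ⟨i, by simpa [sameCycle_permCongr] using hi⟩

lemma cycleCount_permCongr {α β : Type*} (e : α ≃ β) (π : Perm α) :
    cycleCount (e.permCongr π) = cycleCount π := by
  rw [((isCycleTransversal_out π).permCongr e).cycleCount_eq]; rfl

lemma permLength_permCongr {α β : Type*} (e : α ≃ β) (π : Perm α) :
    permLength (e.permCongr π) = permLength π := by
  rw [permLength, permLength, cycleCount_permCongr, Nat.card_congr e]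

lemma cycleProd_permCongr {α β M : Type*} [CommMonoid M] [Finite α] (e : α ≃ β) (π : Perm α)
    {g : β → M} (hg : CycleConstant (e.permCongr π) g) :
    cycleProd (e.permCongr π) g = cycleProd π (g ∘ e) := by
  have : Finite β := Finite.of_equiv _ e
  rw [cycleProd_eq ((isCycleTransversal_out π).permCongr e) hg]; rfl

lemma minimalPeriod_permCongr {α β : Type*} (e : α ≃ β) (π : Perm α) (x : α) :
    Function.minimalPeriod (e.permCongr π) (e x) = Function.minimalPeriod π x := by
  refine Function.minimalPeriod_eq_minimalPeriod_iff.2 fun n => ?_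
  have : (e.permCongr π)^[n] (e x) = e (π^[n] x) := by
    have h : Function.Semiconj e π (e.permCongr π) := fun y => by simp [Equiv.permCongr_apply]
    exact ((h.iterate_right n).eq x).symm
  simp [Function.IsPeriodicPt, Function.IsFixedPt, this]

/-- On a finite set nonnegative powers already exhaust a cycle, so forward invariance suffices. -/
lemma sameCycle_of_invariant {α : Type*} [Finite α] {π : Perm α} {P : α → Prop}
    (hP : ∀ x, P x → P (π x)) {x y : α} (h : π.SameCycle x y) (hx : P x) : P y := by
  obtain ⟨n, rfl⟩ := h.exists_nat_pow_eq
  clear h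
  induction n with
  | zero => exact hx
  | succ n ih => rw [pow_succ', Perm.mul_apply]; exact hP _ ih

lemma cycleConstant_minimalPeriod {α : Type*} [Finite α] (π : Perm α) :
    CycleConstant π fun x => Function.minimalPeriod π x := fun x =>
  Function.minimalPeriod_apply (Function.mem_periodicPts.2
    ⟨orderOf π, orderOf_pos π, by
      simp [Function.IsPeriodicPt, Function.IsFixedPt, Perm.iterate_eq_pow, pow_orderOf_eq_one]⟩)

/-! ### Disjoint sums and families of permutations -/

lemma sumCongr_iterate_inl {α β : Type*} (π : Perm α) (ρ : Perm β) (n : ℕ) (x : α) :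
    (Perm.sumCongr π ρ)^[n] (Sum.inl x) = Sum.inl (π^[n] x) := by
  induction n with
  | zero => rfl
  | succ n ih => rw [Function.iterate_succ_apply', ih, Function.iterate_succ_apply']; rfl

lemma sumCongr_iterate_inr {α β : Type*} (π : Perm α) (ρ : Perm β) (n : ℕ) (x : β) :
    (Perm.sumCongr π ρ)^[n] (Sum.inr x) = Sum.inr (ρ^[n] x) := by
  induction n with
  | zero => rfl
  | succ n ih => rw [Function.iterate_succ_apply', ih, Function.iterate_succ_apply']; rfl

lemma minimalPeriod_sumCongr_inl {α β : Type*} (π : Perm α) (ρ : Perm β) (x : α) :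
    Function.minimalPeriod (Perm.sumCongr π ρ) (Sum.inl x) = Function.minimalPeriod π x :=
  Function.minimalPeriod_eq_minimalPeriod_iff.2 fun n => by
    simp [Function.IsPeriodicPt, Function.IsFixedPt, sumCongr_iterate_inl]

lemma minimalPeriod_sumCongr_inr {α β : Type*} (π : Perm α) (ρ : Perm β) (x : β) :
    Function.minimalPeriod (Perm.sumCongr π ρ) (Sum.inr x) = Function.minimalPeriod ρ x :=
  Function.minimalPeriod_eq_minimalPeriod_iff.2 fun n => by
    simp [Function.IsPeriodicPt, Function.IsFixedPt, sumCongr_iterate_inr]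

lemma sameCycle_iff_iterate {α : Type*} [Finite α] {π : Perm α} {x y : α} :
    π.SameCycle x y ↔ ∃ n : ℕ, π^[n] x = y := by
  constructor
  · intro h
    obtain ⟨n, hn⟩ := h.exists_nat_pow_eq
    exact ⟨n, by rw [Perm.iterate_eq_pow, hn]⟩
  · rintro ⟨n, hn⟩
    exact ⟨n, by rw [← hn, Perm.iterate_eq_pow]; simp⟩

section Sum
variable {α β : Type*} [Finite α] [Finite β] (π : Perm α) (ρ : Perm β)

@[simp] lemma sameCycle_sumCongr_inl {x y : α} :
    (Perm.sumCongr π ρ).SameCycle (Sum.inl x) (Sum.inl y) ↔ π.SameCycle x y := by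
  simp [sameCycle_iff_iterate, sumCongr_iterate_inl]

@[simp] lemma sameCycle_sumCongr_inr {x y : β} :
    (Perm.sumCongr π ρ).SameCycle (Sum.inr x) (Sum.inr y) ↔ ρ.SameCycle x y := by
  simp [sameCycle_iff_iterate, sumCongr_iterate_inr]

@[simp] lemma not_sameCycle_sumCongr_inl_inr {x : α} {y : β} :
    ¬ (Perm.sumCongr π ρ).SameCycle (Sum.inl x) (Sum.inr y) := by
  simp [sameCycle_iff_iterate, sumCongr_iterate_inl]

@[simp] lemma not_sameCycle_sumCongr_inr_inl {x : β} {y : α} :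
    ¬ (Perm.sumCongr π ρ).SameCycle (Sum.inr x) (Sum.inl y) := by
  simp [sameCycle_iff_iterate, sumCongr_iterate_inr]

variable {π ρ}

lemma IsCycleTransversal.sumCongr {ι κ : Type*} {f : ι → α} {g : κ → β}
    (hf : IsCycleTransversal π f) (hg : IsCycleTransversal ρ g) :
    IsCycleTransversal (Perm.sumCongr π ρ) (Sum.map f g) where
  inj i j h := by
    rcases i with i | i <;> rcases j with j | j <;> simp at h ⊢
    · exact hf.inj i j h
    · exact hg.inj i j h
  surj x := by
    rcases x with x | x
    · obtain ⟨i, hi⟩ := hf.surj x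
      exact ⟨Sum.inl i, by simpa using hi⟩
    · obtain ⟨i, hi⟩ := hg.surj x
      exact ⟨Sum.inr i, by simpa using hi⟩

variable (π ρ)

lemma cycleCount_sumCongr : cycleCount (Perm.sumCongr π ρ) = cycleCount π + cycleCount ρ := by
  rw [((isCycleTransversal_out π).sumCongr (isCycleTransversal_out ρ)).cycleCount_eq,
    Nat.card_sum]; rfl

lemma permLength_sumCongr :
    permLength (Perm.sumCongr π ρ) = permLength π + permLength ρ := by
  have h1 := permLength_add_cycleCount π
  have h2 := permLength_add_cycleCount ρ
  have h3 := permLength_add_cycleCount (Perm.sumCongr π ρ)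
  rw [cycleCount_sumCongr, Nat.card_sum] at h3
  omega

lemma cycleProd_sumCongr {M : Type*} [CommMonoid M] {g : α ⊕ β → M}
    (hg : CycleConstant (Perm.sumCongr π ρ) g) :
    cycleProd (Perm.sumCongr π ρ) g =
      cycleProd π (g ∘ Sum.inl) * cycleProd ρ (g ∘ Sum.inr) := by
  classical
  rw [cycleProd_eq ((isCycleTransversal_out π).sumCongr (isCycleTransversal_out ρ)) hg]
  have := Fintype.ofFinite (Quotient (Perm.SameCycle.setoid π))
  have := Fintype.ofFinite (Quotient (Perm.SameCycle.setoid ρ))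
  simp only [cycleProd, finprod_eq_prod_of_fintype, Fintype.prod_sum_type]
  rfl

end Sum

/-- The permutation of `ι × α` that acts by `τ r` on the copy `{r} × α` of `α`. -/
def blockPerm {ι α : Type*} (τ : ι → Perm α) : Perm (ι × α) where
  toFun x := (x.1, τ x.1 x.2)
  invFun x := (x.1, (τ x.1).symm x.2)
  left_inv x := by simp
  right_inv x := by simp

lemma blockPerm_iterate {ι α : Type*} (τ : ι → Perm α) (n : ℕ) (x : ι × α) :
    (blockPerm τ)^[n] x = (x.1, (τ x.1)^[n] x.2) := by
  induction n with
  | zero => rfl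
  | succ n ih => rw [Function.iterate_succ_apply', ih, Function.iterate_succ_apply']; rfl

lemma minimalPeriod_blockPerm {ι α : Type*} (τ : ι → Perm α) (x : ι × α) :
    Function.minimalPeriod (blockPerm τ) x = Function.minimalPeriod (τ x.1) x.2 :=
  Function.minimalPeriod_eq_minimalPeriod_iff.2 fun n => by
    simp [Function.IsPeriodicPt, Function.IsFixedPt, blockPerm_iterate, Prod.ext_iff]

section Sigma
variable {ι α : Type*} [Finite ι] [Finite α] (τ : ι → Perm α)

lemma sameCycle_blockPerm {x y : ι × α} :
    (blockPerm τ).SameCycle x y ↔ x.1 = y.1 ∧ (τ x.1).SameCycle x.2 y.2 := by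
  simp only [sameCycle_iff_iterate, blockPerm_iterate, Prod.ext_iff, exists_and_left]

lemma isCycleTransversal_blockPerm :
    IsCycleTransversal (blockPerm τ)
      (fun s : Σ r, Quotient (Perm.SameCycle.setoid (τ r)) => (s.1, s.2.out)) where
  inj i j h := by
    obtain ⟨i1, i2⟩ := i
    obtain ⟨j1, j2⟩ := j
    rw [sameCycle_blockPerm] at h
    obtain ⟨h1, h2⟩ := h
    dsimp only at h1 h2
    subst h1
    rw [(isCycleTransversal_out (τ i1)).inj _ _ h2]
  surj x := by
    obtain ⟨i, hi⟩ := (isCycleTransversal_out (τ x.1)).surj x.2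
    exact ⟨⟨x.1, i⟩, (sameCycle_blockPerm τ).2 ⟨rfl, hi⟩⟩

lemma cycleCount_blockPerm [Fintype ι] : cycleCount (blockPerm τ) = ∑ r, cycleCount (τ r) := by
  rw [(isCycleTransversal_blockPerm τ).cycleCount_eq, Nat.card_sigma]; rfl

lemma cycleProd_blockPerm [Fintype ι] {M : Type*} [CommMonoid M] {g : ι × α → M}
    (hg : CycleConstant (blockPerm τ) g) :
    cycleProd (blockPerm τ) g = ∏ r, cycleProd (τ r) fun x => g (r, x) := by
  classical
  rw [cycleProd_eq (isCycleTransversal_blockPerm τ) hg]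
  have := fun r => Fintype.ofFinite (Quotient (Perm.SameCycle.setoid (τ r)))
  simp only [cycleProd, finprod_eq_prod_of_fintype, Fintype.prod_sigma]

end Sigma

/-! ### Multiplying by a transposition -/

/-- Identifying two classes of an equivalence relation. -/
lemma exists_setoid_join {α : Type*} [Finite α] (E : Setoid α) (x y : α) :
    ∃ E' : Setoid α, (∀ a b, E a b → E' a b) ∧ E' x y ∧
      (∀ E'' : Setoid α, (∀ a b, E a b → E'' a b) → E'' x y → ∀ a b, E' a b → E'' a b) ∧
      (E x y → E' = E) ∧
      (¬ E x y → Nat.card (Quotient E') + 1 = Nat.card (Quotient E)) := by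
  classical
  -- `f` redirects the class of `y` to that of `x`; the joined relation is its kernel.
  let f : α → Quotient E := fun z => if E z y then Quotient.mk E x else Quotient.mk E z
  have hf : ∀ a b, f a = f b ↔ E a b ∨ ((E a x ∨ E a y) ∧ (E b x ∨ E b y)) := by
    intro a b
    have s : ∀ {a b}, E a b → E b a := fun h => E.symm h
    have t : ∀ {a b c}, E a b → E b c → E a c := fun h h' => E.trans h h'
    have q : ∀ {a b}, Quotient.mk E a = Quotient.mk E b ↔ E a b := Quotient.eq
    by_cases ha : E a y <;> by_cases hb : E b y <;> simp only [f, ha, hb, if_true, if_false, q]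
    · simp
    · constructor
      · intro h; exact Or.inr ⟨Or.inr trivial, Or.inl (s h)⟩
      · rintro (h | ⟨-, h | h⟩)
        · exact absurd (t (s h) ha) hb
        · exact s h
        · exact h.elim
    · constructor
      · intro h; exact Or.inr ⟨Or.inl h, Or.inr trivial⟩
      · rintro (h | ⟨h | h, -⟩)
        · exact absurd (t h hb) ha
        · exact h
        · exact h.elim
    · constructor
      · exact Or.inl
      · rintro (h | ⟨h | h, h' | h'⟩)
        · exact h
        · exact t h (s h')
        all_goals exact False.elim ‹_›
  have hk : ∀ a b, (Setoid.ker f) a b ↔ E a b ∨ ((E a x ∨ E a y) ∧ (E b x ∨ E b y)) := hf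
  refine ⟨Setoid.ker f, fun a b h => (hk a b).2 (Or.inl h),
    (hk x y).2 (Or.inr ⟨Or.inl (E.refl x), Or.inr (E.refl y)⟩), ?_, ?_, ?_⟩
  · intro E'' h1 h2 a b h
    rcases (hk a b).1 h with h | ⟨h | h, h' | h'⟩
    · exact h1 _ _ h
    · exact E''.trans (h1 _ _ h) (E''.symm (h1 _ _ h'))
    · exact E''.trans (h1 _ _ h) (E''.trans h2 (E''.symm (h1 _ _ h')))
    · exact E''.trans (h1 _ _ h) (E''.trans (E''.symm h2) (E''.symm (h1 _ _ h')))
    · exact E''.trans (h1 _ _ h) (E''.symm (h1 _ _ h'))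
  · intro hxy
    ext a b
    rw [hk]
    refine ⟨?_, Or.inl⟩
    rintro (h | ⟨h | h, h' | h'⟩)
    · exact h
    · exact E.trans h (E.symm h')
    · exact E.trans h (E.trans hxy (E.symm h'))
    · exact E.trans h (E.trans (E.symm hxy) (E.symm h'))
    · exact E.trans h (E.symm h')
  · intro hxy
    -- The redirected class of `y` is the only value that is lost, hence the drop by one.
    have hr : Set.range f = {Quotient.mk E y}ᶜ := by
      ext q
      induction q using Quotient.inductionOn with | _ z => ?_
      simp only [Set.mem_range, Set.mem_compl_iff, Set.mem_singleton_iff]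
      constructor
      · rintro ⟨w, hw⟩ h
        have h1 : f w = Quotient.mk E y := hw.trans h
        by_cases h2 : E w y
        · simp only [f, h2, if_true] at h1; exact hxy (Quotient.exact h1)
        · simp only [f, h2, if_false] at h1; exact h2 (Quotient.exact h1)
      · intro h
        have h2 : ¬ E z y := fun h2 => h (Quotient.sound h2)
        exact ⟨z, by simp [f, h2]⟩
    have := Fintype.ofFinite (Quotient E)
    rw [Nat.card_congr (Setoid.quotientKerEquivRange f), hr]
    have h3 := Set.ncard_add_ncard_compl ({Quotient.mk E y} : Set (Quotient E))
    rw [Set.ncard_singleton] at h3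
    rw [Nat.card_coe_set_eq]
    omega

lemma sameCycle_le_setoid {α : Type*} [Finite α] {π : Perm α} {E : Setoid α}
    (h : ∀ x, E x (π x)) {x y : α} (hxy : π.SameCycle x y) : E x y :=
  sameCycle_of_invariant (P := fun z => E x z) (fun z hz => E.trans hz (h z)) hxy (E.refl x)

lemma setoid_swap_apply {α : Type*} [DecidableEq α] {E : Setoid α} {x y : α} (h : E x y) (z : α) :
    E z (swap x y z) := by
  rcases eq_or_ne z x with rfl | hx
  · simpa using h
  rcases eq_or_ne z y with rfl | hy
  · simpa using E.symm h
  · rw [swap_apply_of_ne_of_ne hx hy]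

/-- Let `n` be least with `(π ^ n) x = y`. The arc `x, π x, …, (π ^ (n - 1)) x` is closed under
`swap x y * π`, since `π` sends its last point to `y`, which is swapped back to `x`. The arc omits
`y`. -/
lemma not_sameCycle_swap_mul {α : Type*} [Finite α] [DecidableEq α] {π : Perm α} {x y : α}
    (hne : x ≠ y) (h : π.SameCycle x y) : ¬ (swap x y * π).SameCycle x y := by
  classical
  obtain ⟨n0, hn0⟩ := h.exists_nat_pow_eq
  have hex : ∃ n, (π ^ n) x = y := ⟨n0, hn0⟩
  set n := Nat.find hex
  have hn : (π ^ n) x = y := Nat.find_spec hex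
  have hmin : ∀ m < n, (π ^ m) x ≠ y := fun m hm => Nat.find_min hex hm
  have hpos : 0 < n := by
    rcases Nat.eq_zero_or_pos n with h0 | h0
    · rw [h0] at hn; exact absurd hn hne
    · exact h0
  intro hsc
  suffices hinv : ∀ z, (∃ m < n, (π ^ m) x = z) → ∃ m < n, (π ^ m) x = (swap x y * π) z by
    obtain ⟨m, hm, hmy⟩ := sameCycle_of_invariant hinv hsc ⟨0, hpos, rfl⟩
    exact hmin m hm hmy
  · rintro z ⟨m, hm, rfl⟩
    have e : (swap x y * π) ((π ^ m) x) = swap x y ((π ^ (m + 1)) x) := by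
      rw [pow_succ', Perm.mul_apply, Perm.mul_apply]
    rw [e]
    rcases Nat.lt_or_ge (m + 1) n with h1 | h1
    · by_cases h2 : (π ^ (m + 1)) x = x
      · exfalso
        -- An early return to `x` would make `y` appear before time `n`.
        have h3 : (π ^ (n - (m + 1))) x = y := by
          rw [← hn]
          conv_rhs => rw [← Nat.sub_add_cancel h1.le, pow_add, Perm.mul_apply, h2]
        exact hmin _ (by omega) h3
      · exact ⟨m + 1, h1, by rw [swap_apply_of_ne_of_ne h2 (hmin _ h1)]⟩
    · have h2 : m + 1 = n := by omega
      exact ⟨0, hpos, by rw [h2, hn]; simp⟩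

/-- The `π`-orbit of `x` never meets `y`, so `swap x y * π` follows it until `π` returns to `x`;
there the transposition diverts to `y`. -/
lemma sameCycle_swap_mul {α : Type*} [Finite α] [DecidableEq α] {π : Perm α} {x y : α}
    (h : ¬ π.SameCycle x y) : (swap x y * π).SameCycle x y := by
  have key : ∀ m : ℕ, (swap x y * π).SameCycle x y ∨
      ((swap x y * π) ^ m) x = (π ^ m) x := by
    intro m
    induction m with
    | zero => exact Or.inr rfl
    | succ m ih =>
      rcases ih with ih | ih
      · exact Or.inl ih
      have e : ((swap x y * π) ^ (m + 1)) x = swap x y ((π ^ (m + 1)) x) := by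
        rw [pow_succ', Perm.mul_apply, ih, pow_succ', Perm.mul_apply, Perm.mul_apply]
      by_cases h2 : (π ^ (m + 1)) x = x
      · left
        rw [h2, swap_apply_left] at e
        exact ⟨((m + 1 : ℕ) : ℤ), by rw [zpow_natCast]; exact e⟩
      · right
        rw [e, swap_apply_of_ne_of_ne h2]
        intro h3
        exact h ⟨((m + 1 : ℕ) : ℤ), by rw [zpow_natCast]; exact h3⟩
  rcases key (orderOf π) with h1 | h1
  · exact h1
  · have hp := orderOf_pos π
    obtain ⟨m, hm⟩ : ∃ m, orderOf π = m + 1 := ⟨orderOf π - 1, by omega⟩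
    rcases key m with h2 | h2
    · exact h2
    · have h3 : π ((π ^ m) x) = x := by
        rw [← Perm.mul_apply, ← pow_succ', ← hm, pow_orderOf_eq_one, Perm.one_apply]
      rw [pow_orderOf_eq_one, Perm.one_apply, hm, pow_succ', Perm.mul_apply, h2, Perm.mul_apply, h3,
        swap_apply_left] at h1
      exact absurd (h1 ▸ Perm.SameCycle.refl _ _) h

/-- Joining `x` with `y` yields the same relation `J` from the cycles of `π` and from those of `swap
x y * π`, as the two permutations differ only by that transposition. Both cycle counts are compared
with the number of classes of `J`. -/
lemma cycleCount_swap_mul_aux {α : Type*} [Finite α] [DecidableEq α] (π : Perm α) (x y : α) :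
    ∃ J : Setoid α,
      (π.SameCycle x y → cycleCount π = Nat.card (Quotient J)) ∧
      (¬ π.SameCycle x y → Nat.card (Quotient J) + 1 = cycleCount π) ∧
      ((swap x y * π).SameCycle x y → cycleCount (swap x y * π) = Nat.card (Quotient J)) ∧
      (¬ (swap x y * π).SameCycle x y →
        Nat.card (Quotient J) + 1 = cycleCount (swap x y * π)) := by
  obtain ⟨J, h1, h2, h3, h4, h5⟩ := exists_setoid_join (Perm.SameCycle.setoid π) x y
  obtain ⟨K, k1, k2, k3, k4, k5⟩ := exists_setoid_join (Perm.SameCycle.setoid (swap x y * π)) x y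
  have hJK : J = K := by
    ext a b
    constructor
    · refine h3 K (fun a b hab => sameCycle_le_setoid (fun z => ?_) hab) k2 a b
      have e1 : K z ((swap x y * π) z) := k1 _ _ (Perm.sameCycle_apply_right.2 (.refl _ _))
      exact K.trans e1 (K.symm (setoid_swap_apply k2 (π z)))
    · refine k3 J (fun a b hab => sameCycle_le_setoid (fun z => ?_) hab) h2 a b
      have e1 : J z (π z) := h1 _ _ (Perm.sameCycle_apply_right.2 (.refl _ _))
      exact J.trans e1 (setoid_swap_apply h2 (π z))
  subst hJK
  exact ⟨J, fun h => by rw [h4 h]; rfl, h5, fun h => by rw [k4 h]; rfl, k5⟩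

lemma cycleCount_swap_mul_of_sameCycle {α : Type*} [Finite α] [DecidableEq α] {π : Perm α}
    {x y : α} (hne : x ≠ y) (h : π.SameCycle x y) :
    cycleCount (swap x y * π) = cycleCount π + 1 := by
  obtain ⟨J, h1, -, -, h4⟩ := cycleCount_swap_mul_aux π x y
  rw [h1 h, h4 (not_sameCycle_swap_mul hne h)]

lemma cycleCount_swap_mul_of_not_sameCycle {α : Type*} [Finite α] [DecidableEq α] {π : Perm α}
    {x y : α} (h : ¬ π.SameCycle x y) :
    cycleCount (swap x y * π) + 1 = cycleCount π := by
  obtain ⟨J, -, h2, h3, -⟩ := cycleCount_swap_mul_aux π x y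
  rw [h3 (sameCycle_swap_mul h), h2 h]

lemma cycleCount_one {α : Type*} [Finite α] : cycleCount (1 : Perm α) = Nat.card α := by
  have : IsCycleTransversal (1 : Perm α) id :=
    ⟨fun i j h => Perm.sameCycle_one.1 h, fun x => ⟨x, .refl _ _⟩⟩
  exact this.cycleCount_eq

lemma permLength_one {α : Type*} [Finite α] : permLength (1 : Perm α) = 0 := by
  simp [permLength, cycleCount_one]

lemma permLength_eq_zero {α : Type*} [Finite α] {π : Perm α} (h : permLength π = 0) : π = 1 := by
  classical
  by_contra hne
  obtain ⟨x, hx⟩ : ∃ x, π x ≠ x := by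
    by_contra! h'
    exact hne (Equiv.ext h')
  have h1 := cycleCount_swap_mul_of_sameCycle (π := π) hx (y := x)
    (Perm.sameCycle_apply_left.2 (.refl _ _))
  have h2 := cycleCount_le (swap (π x) x * π)
  have h3 := permLength_add_cycleCount π
  omega

/-- Every permutation is a product of `|π|` transpositions. -/
lemma exists_swap_list {α : Type*} [Finite α] [DecidableEq α] (π : Perm α) :
    ∃ l : List (α × α), l.length = permLength π ∧ (∀ t ∈ l, t.1 ≠ t.2) ∧
      (l.map fun t => swap t.1 t.2).prod = π := by
  induction h : permLength π generalizing π with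
  | zero => exact ⟨[], rfl, by simp, by simp [permLength_eq_zero h]⟩
  | succ n ih =>
    obtain ⟨x, hx⟩ : ∃ x, π x ≠ x := by
      by_contra! h'
      have : π = 1 := Equiv.ext h'
      rw [this, permLength_one] at h
      omega
    have h1 := cycleCount_swap_mul_of_sameCycle (π := π) hx (y := x)
      (Perm.sameCycle_apply_left.2 (.refl _ _))
    have h2 := permLength_add_cycleCount (swap (π x) x * π)
    have h3 := permLength_add_cycleCount π
    obtain ⟨l, hl, hl', hp⟩ := ih (swap (π x) x * π) (by omega)
    refine ⟨(π x, x) :: l, by simp [hl], ?_, ?_⟩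
    · intro t ht
      rcases List.mem_cons.1 ht with rfl | ht
      · exact hx
      · exact hl' t ht
    · rw [List.map_cons, List.prod_cons, hp, ← mul_assoc, swap_mul_self, one_mul]

lemma sign_eq_permLength {α : Type*} [Fintype α] [DecidableEq α] (π : Perm α) :
    Perm.sign π = (-1) ^ permLength π := by
  obtain ⟨l, hl, hne, hp⟩ := exists_swap_list π
  rw [← hl]
  conv_lhs => rw [← hp]
  clear hl hp
  induction l with
  | nil => simp
  | cons t l ih =>
    rw [List.map_cons, List.prod_cons, map_mul, ih fun t ht => hne t (List.mem_cons_of_mem _ ht),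
      Perm.sign_swap (hne t List.mem_cons_self), List.length_cons, pow_succ']

/-! ### The genus inequality -/

/-- `E` is built by joining the two points of each transposition, starting from the discrete
relation. If a new transposition joins two classes of `E`, it also joins two cycles of the partial
product, since these lie inside classes. The right side then changes by -2 + 1 + 1 = 0. Otherwise
`E` is unchanged, the length of the product changes by ±1, and the list grows by one, so the right
side does not decrease. -/
lemma genus_swap_list {α : Type*} [Finite α] [DecidableEq α] (l : List (α × α))
    (hl : ∀ t ∈ l, t.1 ≠ t.2) :
    ∃ E : Setoid α, (∀ t ∈ l, E t.1 t.2) ∧ 2 * Nat.card α ≤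
      2 * Nat.card (Quotient E) + permLength (l.map fun t => swap t.1 t.2).prod + l.length := by
  induction l with
  | nil =>
    refine ⟨⊥, by simp, ?_⟩
    have : Nat.card (Quotient (⊥ : Setoid α)) = Nat.card α :=
      (Nat.card_congr (Equiv.ofBijective (Quotient.mk (⊥ : Setoid α))
        ⟨fun a b h => (Quotient.exact h : (⊥ : Setoid α) a b), Quotient.mk_surjective⟩)).symm
    omega
  | cons t l ih =>
    obtain ⟨E, h1, h2⟩ := ih fun t ht => hl t (List.mem_cons_of_mem _ ht)
    obtain ⟨E', e1, e2, -, e4, e5⟩ := exists_setoid_join E t.1 t.2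
    refine ⟨E', ?_, ?_⟩
    · intro s hs
      rcases List.mem_cons.1 hs with rfl | hs
      · exact e2
      · exact e1 _ _ (h1 s hs)
    set P := (l.map fun t => swap t.1 t.2).prod with hP
    have hne : t.1 ≠ t.2 := hl t List.mem_cons_self
    rw [List.map_cons, List.prod_cons, ← hP, List.length_cons]
    have c1 := permLength_add_cycleCount (swap t.1 t.2 * P)
    have c2 := permLength_add_cycleCount P
    have hEP : ∀ x, E x (P x) := by
      rw [hP]
      clear_value P
      clear * - h1
      induction l with
      | nil => intro x; exact E.refl x
      | cons s l ih =>
        intro x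
        rw [List.map_cons, List.prod_cons, Perm.mul_apply]
        exact E.trans (ih (fun t ht => h1 t (List.mem_cons_of_mem _ ht)) x)
          (setoid_swap_apply (h1 s List.mem_cons_self) _)
    by_cases hE : E t.1 t.2
    · rw [e4 hE]
      by_cases hs : P.SameCycle t.1 t.2
      · have := cycleCount_swap_mul_of_sameCycle hne hs
        omega
      · have := cycleCount_swap_mul_of_not_sameCycle hs
        omega
    · have h3 := e5 hE
      have := cycleCount_swap_mul_of_not_sameCycle
        (fun hs => hE (sameCycle_le_setoid hEP hs) : ¬ P.SameCycle t.1 t.2)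
      omega

/-- The genus inequality: there is an equivalence relation that is invariant under all factors and
has many classes. -/
lemma exists_setoid_genus {α : Type*} [Finite α] (l : List (Perm α)) :
    ∃ E : Setoid α, (∀ τ ∈ l, ∀ x, E x (τ x)) ∧ 2 * Nat.card α ≤
      2 * Nat.card (Quotient E) + permLength l.prod + (l.map permLength).sum := by
  classical
  -- Each factor is written with as many transpositions as its length; a relation that contains all
  -- of them is invariant under every factor.
  have h : ∃ L : List (α × α), L.length = (l.map permLength).sum ∧ (∀ t ∈ L, t.1 ≠ t.2) ∧
      (L.map fun t => swap t.1 t.2).prod = l.prod ∧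
      ∀ E : Setoid α, (∀ t ∈ L, E t.1 t.2) → ∀ τ ∈ l, ∀ x, E x (τ x) := by
    induction l with
    | nil => exact ⟨[], rfl, by simp, rfl, by simp⟩
    | cons τ l ih =>
      obtain ⟨L, h1, h2, h3, h4⟩ := ih
      obtain ⟨K, k1, k2, k3⟩ := exists_swap_list τ
      refine ⟨K ++ L, by simp [h1, k1], ?_, by simp [h3, k3], ?_⟩
      · intro t ht
        rcases List.mem_append.1 ht with ht | ht
        exacts [k2 t ht, h2 t ht]
      · intro E hE σ hσ
        rcases List.mem_cons.1 hσ with rfl | hσ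
        · rw [← k3]
          have hK : ∀ t ∈ K, E t.1 t.2 := fun t ht => hE t (List.mem_append_left _ ht)
          clear * - hK
          induction K with
          | nil => intro x; exact E.refl x
          | cons s K ih =>
            intro x
            rw [List.map_cons, List.prod_cons, Perm.mul_apply]
            exact E.trans (ih (fun t ht => hK t (List.mem_cons_of_mem _ ht)) x)
              (setoid_swap_apply (hK s List.mem_cons_self) _)
        · exact h4 E (fun t ht => hE t (List.mem_append_right _ ht)) σ hσ
  obtain ⟨L, h1, h2, h3, h4⟩ := h
  obtain ⟨E, e1, e2⟩ := genus_swap_list L h2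
  exact ⟨E, h4 E e1, by rw [← h3, ← h1]; exact e2⟩

/-- The surjection from the cycles of the product onto the classes of an invariant equivalence
relation. -/
lemma exists_cycle_surjection {α : Type*} [Finite α] {l : List (Perm α)} {E : Setoid α}
    (h : ∀ τ ∈ l, ∀ x, E x (τ x)) :
    ∃ f : Quotient (Perm.SameCycle.setoid l.prod) → Quotient E,
      Function.Surjective f ∧ ∀ x, f (Quotient.mk _ x) = Quotient.mk _ x := by
  have hp : ∀ x, E x (l.prod x) := by
    induction l with
    | nil => exact fun x => E.refl x
    | cons s l ih =>
      intro x
      rw [List.prod_cons, Perm.mul_apply]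
      exact E.trans (ih (fun t ht => h t (List.mem_cons_of_mem _ ht)) x) (h s List.mem_cons_self _)
  refine ⟨Quotient.map' id fun a b hab => sameCycle_le_setoid hp hab, fun q => ?_, fun x => rfl⟩
  induction q using Quotient.inductionOn with | _ x => exact ⟨Quotient.mk _ x, rfl⟩

/-- The cycles of the product refine `E`, so `E` has at most n - |product| classes; insert this in
the genus inequality. -/
lemma permLength_prod_le {α : Type*} [Finite α] (l : List (Perm α)) :
    permLength l.prod ≤ (l.map permLength).sum := by
  obtain ⟨E, h1, h2⟩ := exists_setoid_genus l
  obtain ⟨f, hf, -⟩ := exists_cycle_surjection h1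
  have h3 : Nat.card (Quotient E) ≤ cycleCount l.prod := Nat.card_le_card_of_surjective f hf
  have h4 := permLength_add_cycleCount l.prod
  omega

/-- Equality of lengths forces `E` to have as many classes as the product has cycles. So the
classes, which are invariant under every factor, are these cycles. -/
lemma sameCycle_prod_of_geodesic {α : Type*} [Finite α] {l : List (Perm α)}
    (hl : (l.map permLength).sum = permLength l.prod) {τ : Perm α} (hτ : τ ∈ l) (x : α) :
    l.prod.SameCycle x (τ x) := by
  obtain ⟨E, h1, h2⟩ := exists_setoid_genus l
  obtain ⟨f, hf, hfx⟩ := exists_cycle_surjection h1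
  have h3 : Nat.card (Quotient E) ≤ cycleCount l.prod := Nat.card_le_card_of_surjective f hf
  have h4 := permLength_add_cycleCount l.prod
  have h5 : Nat.card (Quotient (Perm.SameCycle.setoid l.prod)) = Nat.card (Quotient E) := by
    change cycleCount l.prod = _
    omega
  have hinj := ((Nat.bijective_iff_surjective_and_card f).2 ⟨hf, h5⟩).1
  have : Quotient.mk (Perm.SameCycle.setoid l.prod) x = Quotient.mk _ (τ x) :=
    hinj (by rw [hfx, hfx]; exact Quotient.sound (h1 τ hτ x))
  exact Quotient.exact this

/-- The sign is multiplicative. This rules out an excess of 1, so an excess that is at most 2 is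
either 0 or 2. -/
lemma permLength_prod_mod_two {α : Type*} [Finite α] (l : List (Perm α)) :
    permLength l.prod % 2 = (l.map permLength).sum % 2 := by
  classical
  have := Fintype.ofFinite α
  have h : Perm.sign l.prod = (-1) ^ (l.map permLength).sum := by
    induction l with
    | nil => simp
    | cons τ l ih =>
      rw [List.prod_cons, map_mul, ih, List.map_cons, List.sum_cons, pow_add, sign_eq_permLength]
  rw [sign_eq_permLength] at h
  rcases Nat.even_or_odd (permLength l.prod) with h1 | h1 <;>
  rcases Nat.even_or_odd (l.map permLength).sum with h2 | h2
  · rw [Nat.even_iff.1 h1, Nat.even_iff.1 h2]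
  · rw [h1.neg_one_pow, h2.neg_one_pow] at h; exact absurd h (by decide)
  · rw [h1.neg_one_pow, h2.neg_one_pow] at h; exact absurd h (by decide)
  · rw [Nat.odd_iff.1 h1, Nat.odd_iff.1 h2]

/-- If the lengths of the factors exceed the length of the product by `2` and some factor leaves
the cycles of the product, then the factors join exactly two cycles. -/
lemma sameCycle_or_of_excess_two {α : Type*} [Finite α] {l : List (Perm α)}
    (hl : (l.map permLength).sum = permLength l.prod + 2) {τ : Perm α} (hτ : τ ∈ l) {x : α}
    (hx : ¬ l.prod.SameCycle x (τ x)) {σ : Perm α} (hσ : σ ∈ l) (y : α) :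
    l.prod.SameCycle y (σ y) ∨
      (l.prod.SameCycle x y ∨ l.prod.SameCycle (τ x) y) ∧
      (l.prod.SameCycle x (σ y) ∨ l.prod.SameCycle (τ x) (σ y)) := by
  obtain ⟨E, h1, h2⟩ := exists_setoid_genus l
  obtain ⟨f, hf, hfx⟩ := exists_cycle_surjection h1
  have h4 := permLength_add_cycleCount l.prod
  let Q := Quotient (Perm.SameCycle.setoid l.prod)
  let mk : α → Q := Quotient.mk (Perm.SameCycle.setoid l.prod)
  have hmk : ∀ {a b}, mk a = mk b ↔ l.prod.SameCycle a b := fun {a b} => Quotient.eq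
  have hE : ∀ ρ ∈ l, ∀ z, f (mk z) = f (mk (ρ z)) := fun ρ hρ z => by
    exact (hfx z).trans ((Quotient.sound (h1 ρ hρ z)).trans (hfx (ρ z)).symm)
  -- `f` is injective away from `mk x`
  let g : {q : Q // q ≠ mk x} → Quotient E := fun q => f q
  have hg : Function.Surjective g := by
    intro e
    obtain ⟨q, rfl⟩ := hf e
    by_cases hq : q = mk x
    · refine ⟨⟨mk (τ x), fun h => hx (hmk.1 h.symm)⟩, ?_⟩
      rw [hq]; exact (hE τ hτ x).symm
    · exact ⟨⟨q, hq⟩, rfl⟩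
  have hc : Nat.card {q : Q // q ≠ mk x} + 1 = cycleCount l.prod := by
    have h3 := Set.ncard_add_ncard_compl ({mk x} : Set Q)
    rw [Set.ncard_singleton] at h3
    have : Nat.card {q : Q // q ≠ mk x} = ({mk x}ᶜ : Set Q).ncard := Nat.card_coe_set_eq _
    rw [this, add_comm, h3]; rfl
  -- Excess 2 gives `E` at least one class fewer than the number of cycles, which is the size of the
  -- domain of `g`; a surjection between such sets is a bijection.
  have hginj : Function.Injective g := by
    refine ((Nat.bijective_iff_surjective_and_card g).2 ⟨hg, ?_⟩).1
    have := Nat.card_le_card_of_surjective g hg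
    omega
  have hτx : mk (τ x) ≠ mk x := fun h => hx (hmk.1 h.symm)
  have hfin : ∀ z, f (mk z) = f (mk x) → mk x = mk z ∨ mk (τ x) = mk z := by
    intro z hz
    by_cases h : mk z = mk x
    · exact Or.inl h.symm
    · right
      have := @hginj ⟨mk (τ x), hτx⟩ ⟨mk z, h⟩ (by
        change f _ = f _
        rw [hz, ← hE τ hτ x])
      exact congrArg Subtype.val this
  by_cases hy : l.prod.SameCycle y (σ y)
  · exact Or.inl hy
  right
  simp only [← hmk] at hy ⊢
  by_cases h : f (mk y) = f (mk x)
  · exact ⟨hfin y h, hfin (σ y) (by rw [← hE σ hσ y, h])⟩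
  · exfalso
    have h' : f (mk (σ y)) ≠ f (mk x) := by rw [← hE σ hσ y]; exact h
    have := @hginj ⟨mk y, fun e => h (by rw [e])⟩ ⟨mk (σ y), fun e => h' (by rw [e])⟩ (hE σ hσ y)
    exact hy (congrArg Subtype.val this)

/-! ### Tuples of permutations -/

/-- The ordered product of a tuple of permutations. -/
def tupleProd {k : ℕ} {M : Type*} [Monoid M] (τ : Fin k → M) : M := (List.ofFn τ).prod

/-- The sum of the lengths of a tuple of permutations. -/
noncomputable def tupleLength {k : ℕ} {α : Type*} (τ : Fin k → Perm α) : ℕ :=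
  ∑ r, permLength (τ r)

lemma tupleProd_map {k : ℕ} {M N : Type*} [Monoid M] [Monoid N] (φ : M →* N) (τ : Fin k → M) :
    tupleProd (fun r => φ (τ r)) = φ (tupleProd τ) := by
  rw [tupleProd, tupleProd, map_list_prod, List.map_ofFn]; rfl

lemma tupleProd_permCongr {k : ℕ} {α β : Type*} (e : α ≃ β) (τ : Fin k → Perm α) :
    tupleProd (fun r => e.permCongr (τ r)) = e.permCongr (tupleProd τ) :=
  tupleProd_map e.permCongrHom.toMonoidHom τ

lemma tupleProd_sumCongr {k : ℕ} {α β : Type*} (τ : Fin k → Perm α) (σ : Fin k → Perm β) :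
    tupleProd (fun r => Perm.sumCongr (τ r) (σ r)) =
      Perm.sumCongr (tupleProd τ) (tupleProd σ) := by
  have h1 : tupleProd τ = (tupleProd fun r => (τ r, σ r)).1 :=
    tupleProd_map (MonoidHom.fst (Perm α) (Perm β)) fun r => (τ r, σ r)
  have h2 : tupleProd σ = (tupleProd fun r => (τ r, σ r)).2 :=
    tupleProd_map (MonoidHom.snd (Perm α) (Perm β)) fun r => (τ r, σ r)
  rw [h1, h2]
  exact tupleProd_map (Perm.sumCongrHom α β) fun r => (τ r, σ r)

lemma tupleLength_permCongr {k : ℕ} {α β : Type*} (e : α ≃ β) (τ : Fin k → Perm α) :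
    tupleLength (fun r => e.permCongr (τ r)) = tupleLength τ := by
  simp [tupleLength, permLength_permCongr]

lemma tupleLength_sumCongr {k : ℕ} {α β : Type*} [Finite α] [Finite β] (τ : Fin k → Perm α)
    (σ : Fin k → Perm β) :
    tupleLength (fun r => Perm.sumCongr (τ r) (σ r)) = tupleLength τ + tupleLength σ := by
  simp [tupleLength, permLength_sumCongr, Finset.sum_add_distrib]

lemma tupleLength_eq {k : ℕ} {α : Type*} (τ : Fin k → Perm α) :
    tupleLength τ = ((List.ofFn τ).map permLength).sum := by
  rw [List.map_ofFn, List.sum_ofFn]; rfl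

section
variable {k : ℕ} {α : Type*} [Finite α] {τ : Fin k → Perm α}

lemma permLength_tupleProd_le : permLength (tupleProd τ) ≤ tupleLength τ := by
  rw [tupleLength_eq]; exact permLength_prod_le _

lemma permLength_tupleProd_mod_two : permLength (tupleProd τ) % 2 = tupleLength τ % 2 := by
  rw [tupleLength_eq]; exact permLength_prod_mod_two _

lemma sameCycle_tupleProd (h : tupleLength τ = permLength (tupleProd τ)) (r : Fin k) (x : α) :
    (tupleProd τ).SameCycle x (τ r x) := by
  rw [tupleLength_eq] at h
  exact sameCycle_prod_of_geodesic h (List.mem_ofFn.2 ⟨r, rfl⟩) x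

lemma sameCycle_or_of_tupleLength (h : tupleLength τ = permLength (tupleProd τ) + 2) {r : Fin k}
    {x : α} (hx : ¬ (tupleProd τ).SameCycle x (τ r x)) (s : Fin k) (y : α) :
    (tupleProd τ).SameCycle y (τ s y) ∨
      ((tupleProd τ).SameCycle x y ∨ (tupleProd τ).SameCycle (τ r x) y) ∧
      ((tupleProd τ).SameCycle x (τ s y) ∨ (tupleProd τ).SameCycle (τ r x) (τ s y)) := by
  rw [tupleLength_eq] at h
  exact sameCycle_or_of_excess_two h (List.mem_ofFn.2 ⟨r, rfl⟩) hx (List.mem_ofFn.2 ⟨s, rfl⟩) y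
end

/-! ### Weights -/

/-- The product over the cycles `V` of `π` of `c |V|`. -/
noncomputable def cycleWeight {α : Type*} (c : ℕ → ℂ) (π : Perm α) : ℂ :=
  cycleProd π fun x => c (Function.minimalPeriod π x)

lemma cycleConstant_comp_minimalPeriod {α M : Type*} [Finite α] (c : ℕ → M) (π : Perm α) :
    CycleConstant π fun x => c (Function.minimalPeriod π x) := fun x =>
  congrArg c (cycleConstant_minimalPeriod π x)

lemma cycleWeight_permCongr {α β : Type*} [Finite α] (c : ℕ → ℂ) (e : α ≃ β) (π : Perm α) :
    cycleWeight c (e.permCongr π) = cycleWeight c π := by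
  have : Finite β := Finite.of_equiv _ e
  rw [cycleWeight, cycleProd_permCongr e π (cycleConstant_comp_minimalPeriod c _), cycleWeight]
  congr 1
  funext x
  simp [minimalPeriod_permCongr]

lemma cycleWeight_sumCongr {α β : Type*} [Finite α] [Finite β] (c : ℕ → ℂ) (π : Perm α)
    (ρ : Perm β) :
    cycleWeight c (Perm.sumCongr π ρ) = cycleWeight c π * cycleWeight c ρ := by
  rw [cycleWeight, cycleProd_sumCongr π ρ (cycleConstant_comp_minimalPeriod c _), cycleWeight,
    cycleWeight]
  congr 2
  · funext x; simp only [Function.comp, minimalPeriod_sumCongr_inl]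
  · funext x; simp only [Function.comp, minimalPeriod_sumCongr_inr]

/-- The weight of a tuple of permutations: the product of the weights of its entries. -/
noncomputable def tupleWeight {k : ℕ} {α : Type*} (c : Fin k → ℕ → ℂ) (τ : Fin k → Perm α) : ℂ :=
  ∏ r, cycleWeight (c r) (τ r)

/-- The minimal factorizations of `u`. -/
def geodesics (k : ℕ) {α : Type*} (u : Perm α) : Set (Fin k → Perm α) :=
  {τ | tupleProd τ = u ∧ tupleLength τ = permLength u}

/-- The factorizations of `u ⊕ v` that connect both summands and exceed the minimal length
by `2`. -/
def annularFactorizations (k : ℕ) {α β : Type*} (u : Perm α) (v : Perm β) :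
    Set (Fin k → Perm (α ⊕ β)) :=
  {τ | tupleProd τ = Perm.sumCongr u v ∧ tupleLength τ = permLength u + permLength v + 2 ∧
    ∃ r a b, τ r (Sum.inl a) = Sum.inr b}

variable {k : ℕ} (c : Fin k → ℕ → ℂ)

/-- The sum of the weights of the minimal factorizations of `u`. -/
noncomputable def geodesicSum {α : Type*} (u : Perm α) : ℂ :=
  ∑ᶠ τ ∈ geodesics k u, tupleWeight c τ

/-- The sum of the weights of the annular factorizations of `u ⊕ v`. -/
noncomputable def annularSum {α β : Type*} (u : Perm α) (v : Perm β) : ℂ :=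
  ∑ᶠ τ ∈ annularFactorizations k u v, tupleWeight c τ

lemma tupleWeight_permCongr {α β : Type*} [Finite α] (e : α ≃ β) (τ : Fin k → Perm α) :
    tupleWeight c (fun r => e.permCongr (τ r)) = tupleWeight c τ := by
  simp [tupleWeight, cycleWeight_permCongr]

lemma tupleWeight_sumCongr {α β : Type*} [Finite α] [Finite β] (τ : Fin k → Perm α)
    (σ : Fin k → Perm β) :
    tupleWeight c (fun r => Perm.sumCongr (τ r) (σ r)) = tupleWeight c τ * tupleWeight c σ := by
  simp [tupleWeight, cycleWeight_sumCongr, Finset.prod_mul_distrib]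

/-- Reindexing a sum over tuples of permutations along an equivalence of the points. -/
lemma finsum_mem_permCongr {α β : Type*} [Finite α] (e : α ≃ β) {S : Set (Fin k → Perm α)}
    {T : Set (Fin k → Perm β)} (h : ∀ τ, (fun r => e.permCongr (τ r)) ∈ T ↔ τ ∈ S) :
    ∑ᶠ τ ∈ T, tupleWeight c τ = ∑ᶠ τ ∈ S, tupleWeight c τ := by
  refine (finsum_mem_eq_of_bijOn (fun τ r => e.permCongr (τ r)) ?_ fun τ _ =>
    (tupleWeight_permCongr c e τ).symm).symm
  exact (Equiv.piCongrRight fun _ : Fin k => e.permCongr).bijOn h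

lemma geodesicSum_permCongr {α β : Type*} [Finite α] (e : α ≃ β) (u : Perm α) :
    geodesicSum c (e.permCongr u) = geodesicSum c u := by
  refine finsum_mem_permCongr c e fun τ => ?_
  simp only [geodesics, Set.mem_ofPred_eq, tupleProd_permCongr, tupleLength_permCongr,
    permLength_permCongr, EmbeddingLike.apply_eq_iff_eq]

lemma permCongr_sumCongr {α β α' β' : Type*} (e : α ≃ α') (f : β ≃ β') (u : Perm α) (v : Perm β) :
    (e.sumCongr f).permCongr (Perm.sumCongr u v) =
      Perm.sumCongr (e.permCongr u) (f.permCongr v) := by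
  ext x
  rcases x with x | x <;> simp [Equiv.permCongr_apply]

lemma annularSum_permCongr {α β α' β' : Type*} [Finite α] [Finite β] (e : α ≃ α') (f : β ≃ β')
    (u : Perm α) (v : Perm β) :
    annularSum c (e.permCongr u) (f.permCongr v) = annularSum c u v := by
  refine finsum_mem_permCongr c (e.sumCongr f) fun τ => ?_
  simp only [annularFactorizations, Set.mem_ofPred_eq, tupleProd_permCongr, tupleLength_permCongr,
    permLength_permCongr, ← permCongr_sumCongr, EmbeddingLike.apply_eq_iff_eq]
  refine and_congr_right fun _ => and_congr_right fun _ => ?_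
  constructor
  · rintro ⟨r, a, b, h⟩
    refine ⟨r, e.symm a, f.symm b, ?_⟩
    rw [Equiv.permCongr_apply, ← Equiv.eq_symm_apply] at h
    simpa using h
  · rintro ⟨r, a, b, h⟩
    refine ⟨r, e a, f b, ?_⟩
    rw [Equiv.permCongr_apply, ← Equiv.eq_symm_apply]
    simpa using h

/-! ### Multiplicativity -/

lemma exists_sumCongr_of_mapsTo {α β : Type*} [Finite α] [Finite β] {τ : Fin k → Perm (α ⊕ β)}
    (h : ∀ r a, ∃ a', τ r (Sum.inl a) = Sum.inl a') :
    ∃ (σ : Fin k → Perm α) (ρ : Fin k → Perm β), τ = fun r => Perm.sumCongr (σ r) (ρ r) := by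
  have h1 : ∀ r, ∃ p : Perm α × Perm β, Perm.sumCongr p.1 p.2 = τ r := fun r => by
    obtain ⟨p, hp⟩ := Perm.mem_sumCongrHom_range_of_perm_mapsTo_inl (σ := τ r) (by
      rintro _ ⟨a, rfl⟩
      obtain ⟨a', ha'⟩ := h r a
      exact ⟨a', ha'.symm⟩)
    exact ⟨p, hp⟩
  choose p hp using h1
  exact ⟨fun r => (p r).1, fun r => (p r).2, funext fun r => (hp r).symm⟩

/-- If no factor mixes the summands, a tuple is a pair of tuples and its weight a product. Both
multiplicativity results below reduce to this. -/
lemma finsum_mem_sumCongr {α β : Type*} [Finite α] [Finite β] {S : Set (Fin k → Perm α)}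
    {S' : Set (Fin k → Perm β)} {T : Set (Fin k → Perm (α ⊕ β))}
    (h1 : ∀ τ ∈ T, ∀ r a, ∃ a', τ r (Sum.inl a) = Sum.inl a')
    (h2 : ∀ σ ρ, (fun r => Perm.sumCongr (σ r) (ρ r)) ∈ T ↔ σ ∈ S ∧ ρ ∈ S') :
    ∑ᶠ τ ∈ T, tupleWeight c τ =
      (∑ᶠ τ ∈ S, tupleWeight c τ) * ∑ᶠ τ ∈ S', tupleWeight c τ := by
  classical
  have e1 : ∑ᶠ τ ∈ T, tupleWeight c τ =
      ∑ᶠ p ∈ S ×ˢ S', tupleWeight c p.1 * tupleWeight c p.2 := by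
    refine (finsum_mem_eq_of_bijOn
      (fun (p : (Fin k → Perm α) × (Fin k → Perm β)) r => Perm.sumCongr (p.1 r) (p.2 r)) ⟨?_, ?_, ?_⟩
      fun p _ => (tupleWeight_sumCongr c p.1 p.2).symm).symm
    · rintro ⟨σ, ρ⟩ ⟨hσ, hρ⟩
      exact (h2 σ ρ).2 ⟨hσ, hρ⟩
    · rintro ⟨σ, ρ⟩ - ⟨σ', ρ'⟩ - h
      have : ∀ r, (σ r, ρ r) = (σ' r, ρ' r) := fun r =>
        Perm.sumCongrHom_injective (congrFun h r)
      exact Prod.ext (funext fun r => congrArg Prod.fst (this r))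
        (funext fun r => congrArg Prod.snd (this r))
    · intro τ hτ
      obtain ⟨σ, ρ, rfl⟩ := exists_sumCongr_of_mapsTo (h1 τ hτ)
      exact ⟨(σ, ρ), (h2 σ ρ).1 hτ, rfl⟩
  rw [e1, finsum_mem_eq_finite_toFinset_sum _ (Set.toFinite _),
    finsum_mem_eq_finite_toFinset_sum _ (Set.toFinite S),
    finsum_mem_eq_finite_toFinset_sum _ (Set.toFinite S'), Finset.sum_mul_sum,
    ← Finset.sum_product']
  refine Finset.sum_congr ?_ fun _ _ => rfl
  ext p
  simp [Set.mem_prod]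

/-- Factors of a minimal factorization stay within the cycles of the product, so none crosses
between the summands. The lengths add, and each part is bounded below by its minimum, so both parts
are minimal. -/
lemma geodesicSum_sumCongr {α β : Type*} [Finite α] [Finite β] (u : Perm α) (v : Perm β) :
    geodesicSum c (Perm.sumCongr u v) = geodesicSum c u * geodesicSum c v := by
  refine finsum_mem_sumCongr c ?_ ?_
  · rintro τ ⟨h1, h2⟩ r a
    rw [← h1] at h2
    have h3 := sameCycle_tupleProd h2 r (Sum.inl a)
    rw [h1] at h3
    rcases h : τ r (Sum.inl a) with a' | b
    · exact ⟨a', rfl⟩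
    · rw [h] at h3; exact absurd h3 (by simp)
  · intro σ ρ
    simp only [geodesics, Set.mem_ofPred_eq, tupleProd_sumCongr, tupleLength_sumCongr,
      permLength_sumCongr]
    have h3 : Perm.sumCongr (tupleProd σ) (tupleProd ρ) = Perm.sumCongr u v ↔
        tupleProd σ = u ∧ tupleProd ρ = v := by
      rw [← Prod.mk.injEq]
      exact (Perm.sumCongrHom_injective (α := α) (β := β)).eq_iff
        (a := (tupleProd σ, tupleProd ρ)) (b := (u, v))
    rw [h3]
    constructor
    · rintro ⟨⟨rfl, rfl⟩, h⟩
      have := permLength_tupleProd_le (τ := σ)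
      have := permLength_tupleProd_le (τ := ρ)
      exact ⟨⟨rfl, by omega⟩, rfl, by omega⟩
    · rintro ⟨⟨rfl, h⟩, rfl, h'⟩
      exact ⟨⟨rfl, rfl⟩, by omega⟩

/-- Excess 2 is used up by joining one cycle of `u` with one of `v`, so no factor reaches `δ`. On `α
⊕ β` the excess is even and nonzero, hence exactly 2, and the part on `δ` is minimal. -/
lemma finsum_mem_annular_sumCongr {α β δ : Type*} [Finite α] [Finite β] [Finite δ]
    (u : Perm α) (v : Perm β) (w : Perm δ) :
    ∑ᶠ τ ∈ {τ : Fin k → Perm ((α ⊕ β) ⊕ δ) |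
        tupleProd τ = Perm.sumCongr (Perm.sumCongr u v) w ∧
        tupleLength τ = permLength u + permLength v + permLength w + 2 ∧
        ∃ r a b, τ r (Sum.inl (Sum.inl a)) = Sum.inl (Sum.inr b)}, tupleWeight c τ =
      annularSum c u v * geodesicSum c w := by
  refine finsum_mem_sumCongr c ?_ ?_
  · rintro τ ⟨h1, h2, r, a, b, hr⟩ s y
    have h3 : tupleLength τ = permLength (tupleProd τ) + 2 := by
      rw [h1, h2, permLength_sumCongr, permLength_sumCongr]
    have h4 := sameCycle_or_of_tupleLength h3 (r := r) (x := Sum.inl (Sum.inl a))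
      (by rw [h1, hr]; simp) s (Sum.inl y)
    rw [h1, hr] at h4
    rcases h : τ s (Sum.inl y) with y' | z
    · exact ⟨y', rfl⟩
    · rw [h] at h4; simp at h4
  · intro σ ρ
    simp only [geodesics, annularFactorizations, Set.mem_ofPred_eq, tupleProd_sumCongr,
      tupleLength_sumCongr]
    have h3 : Perm.sumCongr (tupleProd σ) (tupleProd ρ) = Perm.sumCongr (Perm.sumCongr u v) w ↔
        tupleProd σ = Perm.sumCongr u v ∧ tupleProd ρ = w := by
      rw [← Prod.mk.injEq]
      exact (Perm.sumCongrHom_injective (α := α ⊕ β) (β := δ)).eq_iff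
        (a := (tupleProd σ, tupleProd ρ)) (b := (Perm.sumCongr u v, w))
    rw [h3]
    have h4 : (∃ r a b, (Perm.sumCongr (σ r) (ρ r)) (Sum.inl (Sum.inl a)) = Sum.inl (Sum.inr b)) ↔
        ∃ r a b, σ r (Sum.inl a) = Sum.inr b := by
      simp
    rw [h4]
    constructor
    · rintro ⟨⟨h5, rfl⟩, h, r, a, b, hr⟩
      have h6 := permLength_tupleProd_le (τ := σ)
      have h7 := permLength_tupleProd_le (τ := ρ)
      have h8 := permLength_tupleProd_mod_two (τ := σ)
      have h9 : tupleLength σ ≠ permLength (tupleProd σ) := by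
        intro h9
        have := sameCycle_tupleProd h9 r (Sum.inl a)
        rw [h5, hr] at this
        simp at this
      rw [h5, permLength_sumCongr] at h6 h8 h9
      refine ⟨⟨h5, by omega, r, a, b, hr⟩, rfl, by omega⟩
    · rintro ⟨⟨h5, h, h'⟩, rfl, h''⟩
      exact ⟨⟨h5, rfl⟩, by omega, h'⟩

/-! ### Splitting off cycles -/

section Split
variable {α : Type*} {p : α → Prop}

lemma not_invariant {u : Perm α} (h : ∀ x, p (u x) ↔ p x) (x : α) : ¬ p (u x) ↔ ¬ p x :=
  not_congr (h x)

/-- The restriction of a permutation to the complement of an invariant set. -/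
def complPerm (u : Perm α) (h : ∀ x, p (u x) ↔ p x) : Perm {x // ¬ p x} :=
  u.subtypePerm (not_invariant h)

lemma permCongr_sumCompl [DecidablePred p] (u : Perm α) (h : ∀ x, p (u x) ↔ p x) :
    (Equiv.sumCompl p).permCongr (Perm.sumCongr (u.subtypePerm h) (complPerm u h)) = u := by
  ext x
  by_cases hx : p x
  · simp [Equiv.permCongr_apply, Equiv.sumCompl_symm_apply_of_pos hx]
  · simp [Equiv.permCongr_apply, Equiv.sumCompl_symm_apply_of_neg hx, complPerm]

lemma permLength_split [Finite α] (u : Perm α) (h : ∀ x, p (u x) ↔ p x) :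
    permLength u = permLength (u.subtypePerm h) + permLength (complPerm u h) := by
  classical
  conv_lhs => rw [← permCongr_sumCompl u h, permLength_permCongr, permLength_sumCongr]

lemma geodesicSum_split [Finite α] (u : Perm α) (h : ∀ x, p (u x) ↔ p x) :
    geodesicSum c u = geodesicSum c (u.subtypePerm h) * geodesicSum c (complPerm u h) := by
  classical
  conv_lhs => rw [← permCongr_sumCompl u h, geodesicSum_permCongr, geodesicSum_sumCongr]

lemma minimalPeriod_subtypePerm (u : Perm α) (h : ∀ x, p (u x) ↔ p x) (x : {x // p x}) :
    Function.minimalPeriod (u.subtypePerm h) x = Function.minimalPeriod u x := by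
  refine Function.minimalPeriod_eq_minimalPeriod_iff.2 fun n => ?_
  rw [Function.IsPeriodicPt, Function.IsFixedPt, Function.IsPeriodicPt, Function.IsFixedPt,
    Perm.iterate_eq_pow, Perm.iterate_eq_pow, Perm.subtypePerm_pow, Subtype.ext_iff]
  rfl
end Split

lemma sameCycle_invariant {α : Type*} (u : Perm α) (x : α) (y : α) :
    u.SameCycle x (u y) ↔ u.SameCycle x y := Perm.sameCycle_apply_right

lemma exists_equiv_finRotate {α : Type*} [Finite α] (u : Perm α) (x : α)
    (h : ∀ y, u.SameCycle x y) :
    ∃ e : Fin (Function.minimalPeriod u x) ≃ α, e.permCongr (finRotate _) = u := by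
  have hb : Function.Bijective fun j : Fin (Function.minimalPeriod u x) => u^[(j : ℕ)] x := by
    constructor
    · intro a b hab
      exact Fin.ext (Function.iterate_injOn_Iio_minimalPeriod a.2 b.2 hab)
    · intro y
      obtain ⟨n, hn⟩ := sameCycle_iff_iterate.1 (h y)
      have hpos : 0 < Function.minimalPeriod u x := by
        refine Function.minimalPeriod_pos_of_mem_periodicPts (Function.mem_periodicPts.2
          ⟨orderOf u, orderOf_pos u, ?_⟩)
        simp [Function.IsPeriodicPt, Function.IsFixedPt, Perm.iterate_eq_pow, pow_orderOf_eq_one]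
      refine ⟨⟨n % Function.minimalPeriod u x, Nat.mod_lt _ hpos⟩, ?_⟩
      simp only [Function.iterate_mod_minimalPeriod_eq, hn]
  refine ⟨Equiv.ofBijective _ hb, ?_⟩
  ext y
  obtain ⟨j, rfl⟩ := (Equiv.ofBijective _ hb).surjective y
  rw [Equiv.permCongr_apply, Equiv.symm_apply_apply]
  change u^[((finRotate _ j : Fin _) : ℕ)] x = u (u^[(j : ℕ)] x)
  rw [← Function.iterate_succ_apply' (⇑u)]
  generalize hm : Function.minimalPeriod u x = m at j
  cases m with
  | zero => exact j.elim0
  | succ m =>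
    rw [coe_finRotate]
    split_ifs with hj
    · subst hj
      have := Function.iterate_minimalPeriod (f := u) (x := x)
      rw [hm] at this
      simpa using this.symm
    · rfl

/-- The restriction to one cycle is conjugate to a standard full cycle, so its sums depend on the
size of the cycle only. -/
lemma exists_equiv_subtypePerm {α : Type*} [Finite α] (u : Perm α) (x : α) :
    ∃ e : Fin (Function.minimalPeriod u x) ≃ {y // u.SameCycle x y},
      e.permCongr (finRotate _) = u.subtypePerm (sameCycle_invariant u x) := by
  have h := exists_equiv_finRotate (u.subtypePerm (sameCycle_invariant u x))
    ⟨x, Perm.SameCycle.refl _ _⟩ fun y => Perm.sameCycle_subtypePerm.2 y.2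
  rwa [minimalPeriod_subtypePerm] at h

lemma isCycleTransversal_complPerm {α ι : Type*} {u : Perm α} {f : ι → α}
    (hf : IsCycleTransversal u f) (i : ι) :
    IsCycleTransversal (complPerm u (sameCycle_invariant u (f i)))
      (fun j : {j // j ≠ i} => ⟨f j, fun h => j.2 (hf.inj _ _ h).symm⟩) where
  inj j j' h := Subtype.ext (hf.inj _ _ (Perm.sameCycle_subtypePerm.1 h))
  surj x := by
    obtain ⟨j, hj⟩ := hf.surj x
    exact ⟨⟨j, fun h => x.2 (h ▸ hj)⟩, Perm.sameCycle_subtypePerm.2 hj⟩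

lemma prod_complPerm {α ι M : Type*} [CommMonoid M] [Fintype ι] [DecidableEq ι] {u : Perm α}
    {f : ι → α} (hf : IsCycleTransversal u f) (i : ι) (G : ℕ → M) :
    ∏ j : {j // j ≠ i}, G (Function.minimalPeriod (complPerm u (sameCycle_invariant u (f i)))
      ⟨f j, fun h => j.2 (hf.inj _ _ h).symm⟩) =
      ∏ j ∈ Finset.univ.erase i, G (Function.minimalPeriod u (f j)) := by
  rw [Finset.prod_subtype (Finset.univ.erase i) (p := fun j => j ≠ i) (by simp)]
  exact Finset.prod_congr rfl fun j _ => congrArg G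
    (minimalPeriod_subtypePerm u (not_invariant (sameCycle_invariant u (f i))) _)

/-- Minimal factorizations factor over the cycles. -/
lemma geodesicSum_eq_prod {α ι : Type*} [Finite α] [Fintype ι] {u : Perm α} {f : ι → α}
    (hf : IsCycleTransversal u f) :
    geodesicSum c u = ∏ i, geodesicSum c (finRotate (Function.minimalPeriod u (f i))) := by
  classical
  induction h : Nat.card α using Nat.strong_induction_on generalizing α ι with
  | _ n ih =>
    rcases isEmpty_or_nonempty ι with hι | ⟨⟨i⟩⟩
    · have hα : IsEmpty α := ⟨fun x => (hf.surj x).elim fun i _ => hι.elim i⟩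
      have hq : ∀ π : Perm α, IsEmpty (Quotient (Perm.SameCycle.setoid π)) := fun π =>
        ⟨fun q => hα.elim q.out⟩
      have hg : geodesics k u = {fun _ => 1} := by
        ext τ
        have h0 : ∀ π : Perm α, permLength π = 0 := fun π => by simp [permLength]
        simp only [geodesics, Set.mem_ofPred_eq, Set.mem_singleton_iff]
        exact ⟨fun _ => Subsingleton.elim _ _, fun _ => ⟨Subsingleton.elim _ _, by
          simp [tupleLength, h0]⟩⟩
      rw [geodesicSum, hg, finsum_mem_singleton, tupleWeight, Finset.univ_eq_empty (α := ι),
        Finset.prod_empty]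
      refine Finset.prod_eq_one fun r _ => ?_
      have := hq 1
      exact finprod_of_isEmpty _
    -- Split off one cycle; the complement has fewer points and the remaining representatives.
    · rw [geodesicSum_split c u (sameCycle_invariant u (f i)),
        ← Finset.mul_prod_erase _ _ (Finset.mem_univ i)]
      congr 1
      · obtain ⟨e, he⟩ := exists_equiv_subtypePerm u (f i)
        rw [← he, geodesicSum_permCongr]
      · have hc : Nat.card {x // ¬ u.SameCycle (f i) x} < n := by
          rw [← h]
          exact Finite.card_subtype_lt (x := f i) (not_not.2 (.refl _ _))
        rw [ih _ hc (isCycleTransversal_complPerm hf i) rfl]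
        exact prod_complPerm hf i fun m => geodesicSum c (finRotate m)

lemma geodesicSum_complPerm {α ι : Type*} [Finite α] [Fintype ι] [DecidableEq ι] {u : Perm α}
    {f : ι → α} (hf : IsCycleTransversal u f) (i : ι) :
    geodesicSum c (complPerm u (sameCycle_invariant u (f i))) =
      ∏ j ∈ Finset.univ.erase i, geodesicSum c (finRotate (Function.minimalPeriod u (f j))) := by
  rw [geodesicSum_eq_prod c (isCycleTransversal_complPerm hf i)]
  exact prod_complPerm hf i fun m => geodesicSum c (finRotate m)

/-- Annular factorizations join exactly one cycle of `u` with one cycle of `v`. -/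
lemma annularSum_eq_sum {α β ι κ : Type*} [Finite α] [Finite β] [Fintype ι] [Fintype κ]
    [DecidableEq ι] [DecidableEq κ] {u : Perm α} {v : Perm β} {f : ι → α} {g : κ → β}
    (hf : IsCycleTransversal u f) (hg : IsCycleTransversal v g) :
    annularSum c u v = ∑ t : ι × κ,
      annularSum c (finRotate (Function.minimalPeriod u (f t.1)))
          (finRotate (Function.minimalPeriod v (g t.2))) *
        (∏ i ∈ Finset.univ.erase t.1,
          geodesicSum c (finRotate (Function.minimalPeriod u (f i)))) *
        ∏ j ∈ Finset.univ.erase t.2,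
          geodesicSum c (finRotate (Function.minimalPeriod v (g j))) := by
  classical
  -- Factorizations are sorted by the pair of cycles that a crossing factor connects.
  let S : ι × κ → Set (Fin k → Perm (α ⊕ β)) := fun t =>
    {τ | tupleProd τ = Perm.sumCongr u v ∧ tupleLength τ = permLength u + permLength v + 2 ∧
      ∃ r a b, τ r (Sum.inl a) = Sum.inr b ∧ u.SameCycle (f t.1) a ∧ v.SameCycle (g t.2) b}
  have hS : annularFactorizations k u v = ⋃ t, S t := by
    ext τ
    simp only [Set.mem_iUnion]
    constructor
    · rintro ⟨h1, h2, r, a, b, h3⟩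
      obtain ⟨i, hi⟩ := hf.surj a
      obtain ⟨j, hj⟩ := hg.surj b
      exact ⟨(i, j), h1, h2, r, a, b, h3, hi, hj⟩
    · rintro ⟨t, h1, h2, r, a, b, h3, -⟩
      exact ⟨h1, h2, r, a, b, h3⟩
  -- With excess 2 any two crossings connect the same two cycles, so the pair is unique.
  have hdisj : Pairwise (Function.onFun Disjoint S) := by
    intro t t' hne
    refine Set.disjoint_left.2 ?_
    rintro τ ⟨h1, h2, r, a, b, h3, ha, hb⟩ ⟨-, -, r', a', b', h3', ha', hb'⟩
    have h4 : tupleLength τ = permLength (tupleProd τ) + 2 := by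
      rw [h1, h2, permLength_sumCongr]
    have h5 := sameCycle_or_of_tupleLength h4 (r := r) (x := Sum.inl a)
      (by rw [h1, h3]; simp) r' (Sum.inl a')
    rw [h1, h3, h3'] at h5
    simp at h5
    exact hne (Prod.ext (hf.inj _ _ ((ha.trans h5.1).trans ha'.symm))
      (hg.inj _ _ ((hb.trans h5.2).trans hb'.symm)))
  rw [annularSum, hS, finsum_mem_iUnion hdisj fun t => Set.toFinite _,
    finsum_eq_sum_of_fintype]
  refine Finset.sum_congr rfl fun t _ => ?_
  obtain ⟨i, j⟩ := t
  dsimp only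
  have hu := sameCycle_invariant u (f i)
  have hv := sameCycle_invariant v (g j)
  rw [← geodesicSum_complPerm c hf i, ← geodesicSum_complPerm c hg j, mul_assoc,
    ← geodesicSum_sumCongr]
  obtain ⟨e1, he1⟩ := exists_equiv_subtypePerm u (f i)
  obtain ⟨e2, he2⟩ := exists_equiv_subtypePerm v (g j)
  rw [← annularSum_permCongr c e1 e2, he1, he2, ← finsum_mem_annular_sumCongr]
  -- Regroup the points as the two joined cycles together, followed by everything else.
  let e := (Equiv.sumSumSumComm {x // u.SameCycle (f i) x} {x // v.SameCycle (g j) x}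
    {x // ¬ u.SameCycle (f i) x} {x // ¬ v.SameCycle (g j) x}).trans
    ((Equiv.sumCompl _).sumCongr (Equiv.sumCompl _))
  refine finsum_mem_permCongr c e fun τ => ?_
  have he : e.permCongr (Perm.sumCongr (Perm.sumCongr (u.subtypePerm hu) (v.subtypePerm hv))
      (Perm.sumCongr (complPerm u hu) (complPerm v hv))) = Perm.sumCongr u v := by
    conv_rhs => rw [← permCongr_sumCompl u hu, ← permCongr_sumCompl v hv, ← permCongr_sumCongr]
    ext x
    obtain ⟨x, rfl⟩ := e.surjective x
    rw [Equiv.permCongr_apply, Equiv.permCongr_apply, Equiv.symm_apply_apply]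
    simp only [e, Equiv.trans_apply, Equiv.symm_apply_apply]
    congr 1
    rcases x with (x | x) | (x | x) <;> rfl
  simp only [S, Set.mem_ofPred_eq, tupleProd_permCongr, tupleLength_permCongr]
  rw [← he, EmbeddingLike.apply_eq_iff_eq]
  refine and_congr_right fun _ => and_congr ?_ ?_
  · rw [permLength_sumCongr, permLength_split u hu, permLength_split v hv]
    constructor <;> intro h <;> omega
  · constructor
    · rintro ⟨r, a, b, h, ha, hb⟩
      refine ⟨r, ⟨a, ha⟩, ⟨b, hb⟩, ?_⟩
      apply e.injective
      have h1 : e (Sum.inl (Sum.inl ⟨a, ha⟩)) = Sum.inl a := rfl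
      have h2 : e (Sum.inl (Sum.inr ⟨b, hb⟩)) = Sum.inr b := rfl
      rw [h2, ← h, ← h1, Equiv.permCongr_apply, Equiv.symm_apply_apply]
    · rintro ⟨r, a, b, h⟩
      refine ⟨r, a, b, ?_, a.2, b.2⟩
      have h1 : e (Sum.inl (Sum.inl a)) = Sum.inl a.1 := rfl
      have h2 : e (Sum.inl (Sum.inr b)) = Sum.inr b.1 := rfl
      rw [← h1, ← h2, Equiv.permCongr_apply, Equiv.symm_apply_apply, h]

/-! ### Spirals -/

/-- The permutation of `k` copies of `α` that moves each copy to the next one, and applies `γ` when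
returning from the last copy to the first one. -/
def spiral (k : ℕ) {α : Type*} (γ : Perm α) : Perm (Fin k × α) :=
  Equiv.prodCongr (finRotate k) (Equiv.refl α) *
    blockPerm fun r : Fin k => if (r : ℕ) + 1 = k then γ else 1

lemma finRotate_val {n : ℕ} (i : Fin n) :
    (finRotate n i : ℕ) = if (i : ℕ) + 1 = n then 0 else (i : ℕ) + 1 := by
  cases n with
  | zero => exact i.elim0
  | succ n =>
    rw [coe_finRotate]
    simp [Fin.ext_iff]

lemma spiral_apply {k : ℕ} {α : Type*} (γ : Perm α) (x : Fin k × α) :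
    spiral k γ x = (finRotate k x.1, if (x.1 : ℕ) + 1 = k then γ x.2 else x.2) := by
  simp only [spiral, Perm.mul_apply, blockPerm, Equiv.coe_fn_mk, Equiv.prodCongr_apply,
    Prod.map, Equiv.refl_apply]
  split_ifs <;> rfl

section Spiral
variable {k : ℕ} {α : Type*} (γ : Perm α) (τ : Fin k → Perm α)

lemma blockPerm_inv : (blockPerm τ)⁻¹ = blockPerm fun r => (τ r)⁻¹ := rfl

lemma spiral_mul_apply (x : Fin k × α) :
    (spiral k γ * (blockPerm τ)⁻¹) x =
      (finRotate k x.1, if (x.1 : ℕ) + 1 = k then γ ((τ x.1)⁻¹ x.2) else (τ x.1)⁻¹ x.2) := by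
  rw [Perm.mul_apply, blockPerm_inv, spiral_apply]; rfl

lemma finRotate_val_modEq (r : Fin k) : (finRotate k r : ℕ) ≡ (r : ℕ) + 1 [MOD k] := by
  rw [finRotate_val]
  split_ifs with h
  · rw [h]; simp [Nat.ModEq]
  · rfl

lemma spiral_iterate_fst (n : ℕ) (x : Fin k × α) :
    (((spiral k γ * (blockPerm τ)⁻¹)^[n] x).1 : ℕ) ≡ (x.1 : ℕ) + n [MOD k] := by
  induction n with
  | zero => rfl
  | succ n ih =>
    rw [Function.iterate_succ_apply', spiral_mul_apply]
    exact (finRotate_val_modEq _).trans (ih.add_right 1)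

lemma spiral_iterate_zero (hk : 0 < k) (x : α) :
    ∀ j (hj : j < k), (spiral k γ * (blockPerm τ)⁻¹)^[j] (⟨0, hk⟩, x) =
      (⟨j, hj⟩, (((List.ofFn τ).take j).prod)⁻¹ x) := by
  intro j
  induction j with
  | zero => intro hj; simp
  | succ j ih =>
    intro hj
    rw [Function.iterate_succ_apply', ih (by omega), spiral_mul_apply]
    refine Prod.ext (Fin.ext ?_) ?_
    · rw [finRotate_val]
      exact if_neg (by simp; omega)
    · dsimp only
      rw [if_neg (by omega), List.take_succ_eq_append_getElem (by simp; omega), List.prod_append]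
      simp

/-- One turn through the copies applies `(τ 0)⁻¹`, `(τ 1)⁻¹`, … in this order and `γ` at the end. So
the first-return map to copy 0 involves only the ordered product of the tuple. -/
lemma spiral_iterate_k (hk : 0 < k) (x : α) :
    (spiral k γ * (blockPerm τ)⁻¹)^[k] (⟨0, hk⟩, x) =
      (⟨0, hk⟩, (γ * (tupleProd τ)⁻¹) x) := by
  obtain ⟨j, rfl⟩ : ∃ j, k = j + 1 := ⟨k - 1, by omega⟩
  rw [Function.iterate_succ_apply', spiral_iterate_zero γ τ hk x j (by omega), spiral_mul_apply]
  refine Prod.ext (Fin.ext ?_) ?_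
  · rw [finRotate_val]; simp
  · dsimp only
    rw [if_pos rfl]
    have : tupleProd τ = ((List.ofFn τ).take j).prod * τ ⟨j, by omega⟩ := by
      rw [tupleProd]
      conv_lhs => rw [← List.take_of_length_le (l := List.ofFn τ) (i := j + 1) (by simp),
        List.take_succ_eq_append_getElem (by simp), List.prod_append, List.getElem_ofFn,
        List.prod_singleton]
    rw [this]
    simp

lemma spiral_iterate_mul (hk : 0 < k) (x : α) (m : ℕ) :
    (spiral k γ * (blockPerm τ)⁻¹)^[k * m] (⟨0, hk⟩, x) =
      (⟨0, hk⟩, (γ * (tupleProd τ)⁻¹)^[m] x) := by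
  induction m with
  | zero => rfl
  | succ m ih =>
    rw [Nat.mul_succ, Nat.add_comm, Function.iterate_add_apply, ih, spiral_iterate_k,
      Function.iterate_succ_apply']

variable [Finite α]

lemma sameCycle_spiral_zero (hk : 0 < k) {x y : α} :
    (spiral k γ * (blockPerm τ)⁻¹).SameCycle (⟨0, hk⟩, x) (⟨0, hk⟩, y) ↔
      (γ * (tupleProd τ)⁻¹).SameCycle x y := by
  rw [sameCycle_iff_iterate, sameCycle_iff_iterate]
  constructor
  · rintro ⟨n, hn⟩
    have h1 := spiral_iterate_fst γ τ n (⟨0, hk⟩, x)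
    rw [hn] at h1
    obtain ⟨m, rfl⟩ : k ∣ n := by
      have h2 : 0 ≡ n [MOD k] := by simpa using h1
      exact (Nat.modEq_zero_iff_dvd).1 h2.symm
    rw [spiral_iterate_mul] at hn
    exact ⟨m, congrArg Prod.snd hn⟩
  · rintro ⟨m, hm⟩
    exact ⟨k * m, by rw [spiral_iterate_mul, hm]⟩

lemma exists_sameCycle_spiral (hk : 0 < k) (x : Fin k × α) :
    ∃ y, (spiral k γ * (blockPerm τ)⁻¹).SameCycle (⟨0, hk⟩, y) x := by
  have h1 := spiral_iterate_fst γ τ (k - x.1) x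
  set z := (spiral k γ * (blockPerm τ)⁻¹)^[k - x.1] x with hz
  have h2 : (z.1 : ℕ) = 0 := by
    have h3 : (x.1 : ℕ) + (k - x.1) = k := by have := x.1.2; omega
    rw [h3] at h1
    have h4 : (z.1 : ℕ) % k = 0 := by simpa [Nat.ModEq] using h1
    rwa [Nat.mod_eq_of_lt z.1.2] at h4
  refine ⟨z.2, ?_⟩
  have h5 : z = (⟨0, hk⟩, z.2) := Prod.ext (Fin.ext h2) rfl
  rw [← h5]
  exact (sameCycle_iff_iterate.2 ⟨_, hz.symm⟩).symm

/-- Every cycle passes through copy 0, where it traces one cycle of the return map. -/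
lemma cycleCount_spiral (hk : 0 < k) :
    cycleCount (spiral k γ * (blockPerm τ)⁻¹) = cycleCount (γ * (tupleProd τ)⁻¹) := by
  refine IsCycleTransversal.cycleCount_eq (f := fun q :
    Quotient (Perm.SameCycle.setoid (γ * (tupleProd τ)⁻¹)) =>
    ((⟨0, hk⟩ : Fin k), q.out)) ⟨fun i j h => ?_, fun x => ?_⟩
  · exact (isCycleTransversal_out _).inj i j ((sameCycle_spiral_zero γ τ hk).1 h)
  · obtain ⟨y, hy⟩ := exists_sameCycle_spiral γ τ hk x
    obtain ⟨q, hq⟩ := (isCycleTransversal_out (γ * (tupleProd τ)⁻¹)).surj y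
    exact ⟨q, ((sameCycle_spiral_zero γ τ hk).2 hq).trans hy⟩

lemma permLength_spiral_mul (hk : 0 < k) :
    permLength (spiral k γ * (blockPerm τ)⁻¹) + Nat.card α =
      k * Nat.card α + permLength (γ * (tupleProd τ)⁻¹) := by
  have h1 := permLength_add_cycleCount (spiral k γ * (blockPerm τ)⁻¹)
  have h2 := permLength_add_cycleCount (γ * (tupleProd τ)⁻¹)
  rw [cycleCount_spiral γ τ hk, Nat.card_prod, Nat.card_fin] at h1
  omega

lemma permLength_spiral (hk : 0 < k) :
    permLength (spiral k γ) + Nat.card α = k * Nat.card α + permLength γ := by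
  have h := permLength_spiral_mul γ (fun _ : Fin k => (1 : Perm α)) hk
  have h1 : (blockPerm fun _ : Fin k => (1 : Perm α)) = 1 := rfl
  have h2 : tupleProd (fun _ : Fin k => (1 : Perm α)) = 1 := by
    simp [tupleProd, List.ofFn_const]
  rwa [h1, h2, inv_one, inv_one, mul_one, mul_one] at h

lemma permLength_blockPerm : permLength (blockPerm τ) = tupleLength τ := by
  have h1 := permLength_add_cycleCount (blockPerm τ)
  rw [cycleCount_blockPerm, Nat.card_prod, Nat.card_fin] at h1
  have h2 : ∑ r, (permLength (τ r) + cycleCount (τ r)) = k * Nat.card α := by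
    simp [permLength_add_cycleCount]
  rw [Finset.sum_add_distrib] at h2
  rw [tupleLength]
  omega

omit [Finite α] in
lemma permLength_mul_inv_comm (π ρ : Perm α) : permLength (π⁻¹ * ρ) = permLength (ρ * π⁻¹) := by
  have : π.permCongr (π⁻¹ * ρ) = ρ * π⁻¹ := by
    ext x; simp
  rw [← this, permLength_permCongr]

/-- The geodesic defect of a family of permutations relative to the spiral. -/
lemma permLength_blockPerm_spiral (hk : 0 < k) (d : ℕ) :
    permLength (blockPerm τ) + permLength ((blockPerm τ)⁻¹ * spiral k γ) =
        permLength (spiral k γ) + d ↔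
      tupleLength τ + permLength ((tupleProd τ)⁻¹ * γ) = permLength γ + d := by
  -- Both spiral lengths exceed the corresponding lengths on `α` by (k - 1) times the number of
  -- points, and this shift cancels.
  have h1 := permLength_spiral_mul γ τ hk
  have h2 := permLength_spiral γ hk
  rw [permLength_blockPerm, permLength_mul_inv_comm, permLength_mul_inv_comm]
  omega

/-- The copy index advances by one at each step, so all periods are multiples of `k`. They all equal
`k` exactly when the return map is the identity. -/
lemma minimalPeriod_spiral_eq_iff (hk : 0 < k) :
    (∀ x, Function.minimalPeriod (spiral k γ * (blockPerm τ)⁻¹) x = k) ↔ tupleProd τ = γ := by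
  constructor
  · intro h
    have : γ * (tupleProd τ)⁻¹ = 1 := by
      ext x
      have h1 := Function.iterate_minimalPeriod (f := spiral k γ * (blockPerm τ)⁻¹)
        (x := (⟨0, hk⟩, x))
      rw [h, spiral_iterate_k] at h1
      exact congrArg Prod.snd h1
    exact (mul_inv_eq_one.1 this).symm
  · intro h x
    obtain ⟨y, hy⟩ := exists_sameCycle_spiral γ τ hk x
    rw [← (cycleConstant_minimalPeriod (spiral k γ * (blockPerm τ)⁻¹)).eq_of_sameCycle hy]
    refine Nat.dvd_antisymm (Function.IsPeriodicPt.minimalPeriod_dvd ?_) ?_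
    · rw [Function.IsPeriodicPt, Function.IsFixedPt, spiral_iterate_k, h]
      simp
    · have h1 := spiral_iterate_fst γ τ
        (Function.minimalPeriod (spiral k γ * (blockPerm τ)⁻¹) (⟨0, hk⟩, y)) (⟨0, hk⟩, y)
      rw [Function.iterate_minimalPeriod] at h1
      exact (Nat.modEq_zero_iff_dvd).1 (by simpa using h1.symm)

end Spiral

/-! ### Residues modulo `k` -/

/-- Sorting the points of a circle by their residue modulo `k`. -/
def residueEquiv (k n : ℕ) : Fin (k * n) ≃ Fin k × Fin n :=
  (finCongr (Nat.mul_comm k n)).trans (finProdFinEquiv.symm.trans (Equiv.prodComm _ _))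

lemma residueEquiv_fst {k n : ℕ} (i : Fin (k * n)) : ((residueEquiv k n i).1 : ℕ) = i % k := by
  simp [residueEquiv]

lemma residueEquiv_snd {k n : ℕ} (i : Fin (k * n)) : ((residueEquiv k n i).2 : ℕ) = i / k := by
  simp [residueEquiv]

/-- Passing from `i` to `i + 1` raises the residue and carries into the quotient only at residue `k
- 1`. This is the twist of the spiral. -/
lemma residueEquiv_finRotate {k n : ℕ} (hk : 0 < k) (i : Fin (k * n)) :
    residueEquiv k n (finRotate (k * n) i) = spiral k (finRotate n) (residueEquiv k n i) := by
  rw [spiral_apply]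
  have hdm := Nat.div_add_mod (i : ℕ) k
  have hlt := Nat.mod_lt (i : ℕ) hk
  have hdl : (i : ℕ) / k < n := Nat.div_lt_of_lt_mul i.2
  refine Prod.ext (Fin.ext ?_) (Fin.ext ?_)
  · dsimp only
    rw [residueEquiv_fst, finRotate_val, finRotate_val, residueEquiv_fst]
    split_ifs with h1 h2 h2
    · simp
    · exfalso
      apply h2
      have h3 : ((i : ℕ) + 1) % k = 0 := by rw [h1]; simp
      rw [Nat.add_mod_eq_ite] at h3
      rcases Nat.lt_or_ge 1 k with h4 | h4
      · rw [Nat.mod_eq_of_lt h4] at h3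
        split_ifs at h3
        omega
      · omega
    · have h3 : (i : ℕ) + 1 = k * ((i : ℕ) / k + 1) := by rw [Nat.mul_add]; omega
      rw [h3]; simp
    · have h3 : (i : ℕ) + 1 = k * ((i : ℕ) / k) + ((i : ℕ) % k + 1) := by omega
      rw [h3, Nat.mul_add_mod, Nat.mod_eq_of_lt (by omega)]
  · dsimp only
    rw [residueEquiv_snd, finRotate_val, residueEquiv_fst]
    by_cases h2 : (i : ℕ) % k + 1 = k
    · rw [if_pos h2, finRotate_val, residueEquiv_snd]
      have h3 : (i : ℕ) + 1 = k * ((i : ℕ) / k + 1) := by rw [Nat.mul_add]; omega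
      have h4 : (i : ℕ) + 1 = k * n ↔ (i : ℕ) / k + 1 = n := by
        rw [h3]; exact ⟨fun h => Nat.eq_of_mul_eq_mul_left hk h, fun h => by rw [h]⟩
      by_cases h5 : (i : ℕ) / k + 1 = n
      · rw [if_pos (h4.2 h5), if_pos h5]; simp
      · rw [if_neg (fun h => h5 (h4.1 h)), if_neg h5, h3, Nat.mul_div_cancel_left _ hk]
    · have h3 : (i : ℕ) + 1 = k * ((i : ℕ) / k) + ((i : ℕ) % k + 1) := by omega
      have h4 : (i : ℕ) + 1 ≠ k * n := by
        intro h
        have : ((i : ℕ) + 1) % k = (i : ℕ) % k + 1 := by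
          conv_lhs => rw [h3, Nat.mul_add_mod, Nat.mod_eq_of_lt (by omega)]
        rw [h] at this
        simp at this
      rw [if_neg h4, if_neg h2, residueEquiv_snd, h3, Nat.mul_add_div hk,
        Nat.div_eq_of_lt (show (i : ℕ) % k + 1 < k by omega), Nat.add_zero]

lemma residueEquiv_permCongr {k n : ℕ} (hk : 0 < k) :
    (residueEquiv k n).permCongr (finRotate (k * n)) = spiral k (finRotate n) := by
  ext1 x
  obtain ⟨i, rfl⟩ := (residueEquiv k n).surjective x
  rw [Equiv.permCongr_apply, Equiv.symm_apply_apply, residueEquiv_finRotate hk]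

/-- Sorting the points of two circles by their residue modulo `k`. -/
def annulusResidueEquiv (k p q : ℕ) : Fin (k * p + k * q) ≃ Fin k × (Fin p ⊕ Fin q) :=
  finSumFinEquiv.symm.trans (((residueEquiv k p).sumCongr (residueEquiv k q)).trans
    (Equiv.prodSumDistrib _ _ _).symm)

lemma annulusResidueEquiv_castAdd {k p q : ℕ} (i : Fin (k * p)) :
    annulusResidueEquiv k p q (Fin.castAdd (k * q) i) =
      ((residueEquiv k p i).1, Sum.inl (residueEquiv k p i).2) := by
  simp [annulusResidueEquiv]

lemma annulusResidueEquiv_natAdd {k p q : ℕ} (i : Fin (k * q)) :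
    annulusResidueEquiv k p q (Fin.natAdd (k * p) i) =
      ((residueEquiv k q i).1, Sum.inr (residueEquiv k q i).2) := by
  simp [annulusResidueEquiv]

lemma annulusResidueEquiv_fst {k p q : ℕ} (i : Fin (k * p + k * q)) :
    ((annulusResidueEquiv k p q i).1 : ℕ) = i % k := by
  refine Fin.addCases (fun i => ?_) (fun i => ?_) i
  · rw [annulusResidueEquiv_castAdd]; simp [residueEquiv_fst]
  · rw [annulusResidueEquiv_natAdd]; simp [residueEquiv_fst]

lemma annulusPerm_castAdd {m n : ℕ} (i : Fin m) :
    annulusPerm m n (Fin.castAdd n i) = Fin.castAdd n (finRotate m i) := by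
  simp [annulusPerm, Equiv.permCongr_apply]

lemma annulusPerm_natAdd {m n : ℕ} (i : Fin n) :
    annulusPerm m n (Fin.natAdd m i) = Fin.natAdd m (finRotate n i) := by
  simp [annulusPerm, Equiv.permCongr_apply]

lemma annulusResidueEquiv_permCongr {k p q : ℕ} (hk : 0 < k) :
    (annulusResidueEquiv k p q).permCongr (annulusPerm (k * p) (k * q)) =
      spiral k (Perm.sumCongr (finRotate p) (finRotate q)) := by
  ext1 x
  obtain ⟨i, rfl⟩ := (annulusResidueEquiv k p q).surjective x
  rw [Equiv.permCongr_apply, Equiv.symm_apply_apply]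
  refine Fin.addCases (fun i => ?_) (fun i => ?_) i
  · rw [annulusPerm_castAdd, annulusResidueEquiv_castAdd, annulusResidueEquiv_castAdd,
      residueEquiv_finRotate hk, spiral_apply, spiral_apply]
    dsimp only
    split_ifs <;> rfl
  · rw [annulusPerm_natAdd, annulusResidueEquiv_natAdd, annulusResidueEquiv_natAdd,
      residueEquiv_finRotate hk, spiral_apply, spiral_apply]
    dsimp only
    split_ifs <;> rfl

/-! ### Cumulants along permutations -/

lemma isCycleTransversal_cycleReps {n : ℕ} (π : Perm (Fin n)) :
    IsCycleTransversal π (fun i : {i // i ∈ cycleReps π} => (i : Fin n)) where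
  inj i j h := by
    have hi := (Finset.mem_filter.1 i.2).2
    have hj := (Finset.mem_filter.1 j.2).2
    exact Subtype.ext (le_antisymm (hi _ h) (hj _ h.symm))
  surj x := by
    classical
    obtain ⟨i, hi, hmin⟩ := Finset.exists_min_image (Finset.univ.filter fun i => π.SameCycle i x)
      (fun i => i) ⟨x, by simp [Perm.SameCycle.refl]⟩
    simp only [Finset.mem_filter, Finset.mem_univ, true_and] at hi hmin
    refine ⟨⟨i, ?_⟩, hi⟩
    rw [cycleReps, Finset.mem_filter]
    exact ⟨Finset.mem_univ _, fun j hj => hmin j (hj.symm.trans hi)⟩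

lemma prod_cycleReps {n : ℕ} {M : Type*} [CommMonoid M] {π : Perm (Fin n)} {g : Fin n → M}
    (hg : CycleConstant π g) : ∏ i ∈ cycleReps π, g i = cycleProd π g := by
  rw [cycleProd_eq (isCycleTransversal_cycleReps π) hg, finprod_eq_prod_of_fintype,
    Finset.prod_coe_sort]

lemma cycleSize_pos {n : ℕ} (π : Perm (Fin n)) (i : Fin n) : 0 < cycleSize π i :=
  Function.minimalPeriod_pos_of_mem_periodicPts (Function.mem_periodicPts.2
    ⟨orderOf π, orderOf_pos π, by
      simp [Function.IsPeriodicPt, Function.IsFixedPt, Perm.iterate_eq_pow, pow_orderOf_eq_one]⟩)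

lemma exists_pow_of_sameCycle {n : ℕ} {π : Perm (Fin n)} {i j : Fin n} (h : π.SameCycle i j) :
    ∃ m : Fin (cycleSize π i), (π ^ (m : ℕ)) i = j := by
  obtain ⟨m, hm⟩ := sameCycle_iff_iterate.1 h
  refine ⟨⟨m % cycleSize π i, Nat.mod_lt _ (cycleSize_pos π i)⟩, ?_⟩
  rw [← Perm.iterate_eq_pow, ← hm]
  exact Function.iterate_mod_minimalPeriod_eq

variable {A : Type*} [Ring A] [Algebra ℂ A]

/-- The free cumulants of a single element. -/
noncomputable def selfCumulant (S : ProbSpace A) (x : A) (m : ℕ) : ℂ := cumulant S m fun _ => x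

lemma permCumulant_const (S : ProbSpace A) {n : ℕ} (π : Perm (Fin n)) (x : A) :
    permCumulant S π (fun _ => x) = ∏ i ∈ cycleReps π, selfCumulant S x (cycleSize π i) := rfl

/-! ### Freeness and colour preserving permutations -/

section Free
variable {S : ProbSpace A} {k : ℕ} {a : Fin k → A}

lemma cumulant_eq_zero_of_mixed (hfree : ElementsSecondOrderFree S a) {n : ℕ} (c : Fin n → Fin k)
    {r s : Fin n} (h : c r ≠ c s) : cumulant S n (fun i => a (c i)) = 0 :=
  hfree.1 n _ c (fun i => Algebra.self_mem_adjoin_singleton ℂ (a (c i))) ⟨r, s, h⟩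

lemma permCumulant_eq_zero_of_mixed (hfree : ElementsSecondOrderFree S a) {n : ℕ}
    (c : Fin n → Fin k) (π : Perm (Fin n)) {i : Fin n} (h : c (π i) ≠ c i) :
    permCumulant S π (fun i => a (c i)) = 0 := by
  obtain ⟨⟨j, hj⟩, hji⟩ := (isCycleTransversal_cycleReps π).surj i
  refine Finset.prod_eq_zero hj ?_
  obtain ⟨m, hm⟩ := exists_pow_of_sameCycle hji
  obtain ⟨m', hm'⟩ := exists_pow_of_sameCycle (Perm.sameCycle_apply_right.2 hji)
  refine cumulant_eq_zero_of_mixed hfree (fun l => c ((π ^ (l : ℕ)) j)) (r := m') (s := m) ?_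
  rwa [hm, hm']

/-- Each cycle stays in one copy `r`, so its entries all equal `a r` and its cumulant depends on the
size alone. -/
lemma permCumulant_blockPerm (S : ProbSpace A) (a : Fin k → A) {N : ℕ} {α : Type*} [Finite α]
    (e : Fin N ≃ Fin k × α) (τ : Fin k → Perm α) :
    permCumulant S (e.symm.permCongr (blockPerm τ)) (fun i => a (e i).1) =
      tupleWeight (fun r => selfCumulant S (a r)) τ := by
  set π := e.symm.permCongr (blockPerm τ) with hπ
  have hcol : CycleConstant π fun i => (e i).1 := fun i => by
    simp [hπ, Equiv.permCongr_apply, blockPerm]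
  have hg : CycleConstant π fun i => selfCumulant S (a (e i).1) (Function.minimalPeriod π i) :=
    fun i => by
      have h1 := hcol i
      have h2 := cycleConstant_minimalPeriod π i
      dsimp only at h1 h2 ⊢
      rw [h1, h2]
  have h1 : permCumulant S π (fun i => a (e i).1) =
      ∏ i ∈ cycleReps π, selfCumulant S (a (e i).1) (Function.minimalPeriod π i) := by
    refine Finset.prod_congr rfl fun i _ => ?_
    refine congrArg (cumulant S _) (funext fun j => ?_)
    change a (e ((π ^ (j : ℕ)) i)).1 = a (e i).1
    rw [hcol.eq_of_sameCycle (x := i) (y := (π ^ (j : ℕ)) i) ⟨(j : ℕ), by simp⟩]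
  rw [h1, prod_cycleReps hg, cycleProd_permCongr e.symm _ hg]
  have h2 : ((fun i => selfCumulant S (a (e i).1) (Function.minimalPeriod π i)) ∘ e.symm) =
      fun x => selfCumulant S (a x.1) (Function.minimalPeriod (τ x.1) x.2) := by
    funext x
    simp only [Function.comp, Equiv.apply_symm_apply, hπ, minimalPeriod_permCongr,
      minimalPeriod_blockPerm]
  rw [h2, cycleProd_blockPerm]
  · rfl
  · intro x
    have := cycleConstant_minimalPeriod (τ x.1) x.2
    dsimp only at this
    simp only [blockPerm, Equiv.coe_fn_mk, this]

lemma exists_blockPerm {N : ℕ} {α : Type*} [Finite α] (e : Fin N ≃ Fin k × α) {π : Perm (Fin N)}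
    (h : ∀ i, (e (π i)).1 = (e i).1) : ∃ τ : Fin k → Perm α, e.symm.permCongr (blockPerm τ) = π := by
  have hinj : ∀ r, Function.Injective fun x => (e (π (e.symm (r, x)))).2 := by
    intro r x y hxy
    have h1 : e (π (e.symm (r, x))) = e (π (e.symm (r, y))) :=
      Prod.ext (by rw [h, h]; simp) hxy
    simpa using h1
  refine ⟨fun r => Equiv.ofBijective _ (Finite.injective_iff_bijective.1 (hinj r)), ?_⟩
  ext1 i
  rw [Equiv.permCongr_apply, Equiv.symm_symm, Equiv.symm_apply_eq]
  refine Prod.ext ?_ ?_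
  · exact (h i).symm
  · simp [blockPerm]

/-- Only the permutations that preserve the colours contribute, and these are families of
permutations indexed by the colours. -/
lemma sum_permCumulant_eq (hfree : ElementsSecondOrderFree S a) {N : ℕ} {α : Type*} [Finite α]
    (e : Fin N ≃ Fin k × α) {s : Finset (Perm (Fin N))} {T : Set (Fin k → Perm α)}
    (h : ∀ τ, e.symm.permCongr (blockPerm τ) ∈ s ↔ τ ∈ T) :
    ∑ π ∈ s, permCumulant S π (fun i => a (e i).1) =
      ∑ᶠ τ ∈ T, tupleWeight (fun r => selfCumulant S (a r)) τ := by
  classical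
  rw [← Finset.sum_filter_of_ne (p := fun π => ∀ i, (e (π i)).1 = (e i).1)]
  swap
  · intro π _ hne
    by_contra! hi
    obtain ⟨i, hi⟩ := hi
    exact hne (permCumulant_eq_zero_of_mixed hfree (fun i => (e i).1) π hi)
  rw [← finsum_mem_coe_finset]
  refine (finsum_mem_eq_of_bijOn (fun τ => e.symm.permCongr (blockPerm τ)) ⟨?_, ?_, ?_⟩
    fun τ _ => (permCumulant_blockPerm S a e τ).symm).symm
  · intro τ hτ
    simp only [Finset.coe_filter, Set.mem_ofPred_eq]
    exact ⟨(h τ).2 hτ, fun i => by simp [Equiv.permCongr_apply, blockPerm]⟩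
  · intro τ _ τ' _ hττ
    have h1 : blockPerm τ = blockPerm τ' := e.symm.permCongr.injective hττ
    funext r
    ext x
    exact congrArg Prod.snd (Equiv.congr_fun h1 (r, x))
  · intro π hπ
    simp only [Finset.coe_filter, Set.mem_ofPred_eq] at hπ
    obtain ⟨τ, rfl⟩ := exists_blockPerm e hπ.2
    exact ⟨τ, (h τ).1 hπ.1, rfl⟩

end Free

/-! ### Membership in `NC` and `S_NC` -/

lemma mem_NC_iff {n : ℕ} {π : Perm (Fin n)} :
    π ∈ NC n ↔ permLength π + permLength (π⁻¹ * finRotate n) = permLength (finRotate n) := by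
  simp [NC, length_eq]

/-- A cycle that leaves `P` does so in a single step. The one-step form is what transports easily to
tuples. -/
lemma exists_sameCycle_iff {α : Type*} [Finite α] (π : Perm α) (P : α → Prop) :
    (∃ x y, P x ∧ ¬ P y ∧ π.SameCycle x y) ↔ ∃ x, P x ∧ ¬ P (π x) := by
  constructor
  · rintro ⟨x, y, hx, hy, h⟩
    by_contra! hP
    exact hy (sameCycle_of_invariant hP h hx)
  · rintro ⟨x, hx, hx'⟩
    exact ⟨x, π x, hx, hx', Perm.sameCycle_apply_right.2 (.refl _ _)⟩

lemma exists_sameCycle_castAdd_natAdd_iff {m n : ℕ} (π : Perm (Fin (m + n))) :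
    (∃ (i : Fin m) (j : Fin n), π.SameCycle (Fin.castAdd n i) (Fin.natAdd m j)) ↔
      ∃ x : Fin (m + n), (x : ℕ) < m ∧ ¬ (π x : ℕ) < m := by
  rw [← exists_sameCycle_iff π fun x => (x : ℕ) < m]
  constructor
  · rintro ⟨i, j, h⟩
    exact ⟨_, _, by simp, by simp, h⟩
  · rintro ⟨x, y, hx, hy, h⟩
    refine ⟨⟨x, hx⟩, ⟨y - m, by omega⟩, ?_⟩
    have h1 : Fin.castAdd n ⟨(x : ℕ), hx⟩ = x := rfl
    have h2 : Fin.natAdd m (⟨(y : ℕ) - m, by omega⟩ : Fin n) = y := Fin.ext (by simp; omega)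
    rwa [h1, h2]

lemma mem_SNC_iff {m n : ℕ} {π : Perm (Fin (m + n))} :
    π ∈ SNC m n ↔ (∃ x : Fin (m + n), (x : ℕ) < m ∧ ¬ (π x : ℕ) < m) ∧
      permLength π + permLength (π⁻¹ * annulusPerm m n) = permLength (annulusPerm m n) + 2 := by
  rw [SNC, Finset.mem_filter, exists_sameCycle_castAdd_natAdd_iff]
  simp [length_eq, Kr]

lemma annulusPerm_lt_iff {m n : ℕ} (x : Fin (m + n)) :
    (annulusPerm m n x : ℕ) < m ↔ (x : ℕ) < m := by
  refine Fin.addCases (fun i => ?_) (fun i => ?_) x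
  · rw [annulusPerm_castAdd]; simp
  · rw [annulusPerm_natAdd]; simp

/-- The Kreweras complement permutes the annular non-crossing permutations. -/
lemma annulusPerm_mul_inv_mem_SNC_iff {m n : ℕ} {π : Perm (Fin (m + n))} :
    annulusPerm m n * π⁻¹ ∈ SNC m n ↔ π ∈ SNC m n := by
  rw [mem_SNC_iff, mem_SNC_iff]
  refine and_congr ?_ ?_
  -- `annulusPerm` preserves the circles, so crossing depends on `π⁻¹` alone, which has the same
  -- cycles as `π`.
  · simp only [Perm.mul_apply, annulusPerm_lt_iff]
    rw [← exists_sameCycle_iff π⁻¹ fun x => (x : ℕ) < m,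
      ← exists_sameCycle_iff π fun x => (x : ℕ) < m]
    simp only [Perm.sameCycle_inv]
  · have h1 : (annulusPerm m n * π⁻¹)⁻¹ * annulusPerm m n = π := by group
    rw [h1, ← permLength_mul_inv_comm, add_comm]

lemma Kr_injective {m n : ℕ} : Function.Injective (Kr (m := m) (n := n)) := fun _ _ h =>
  inv_injective (mul_right_cancel h)

lemma Kr_eq_iff {m n : ℕ} {π ρ : Perm (Fin (m + n))} : Kr π = ρ ↔ annulusPerm m n * ρ⁻¹ = π := by
  rw [Kr]
  constructor
  · rintro rfl; group
  · rintro rfl; group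

lemma permCongr_mul {α β : Type*} (e : α ≃ β) (π ρ : Perm α) :
    e.permCongr (π * ρ) = e.permCongr π * e.permCongr ρ := map_mul e.permCongrHom π ρ

lemma permCongr_inv {α β : Type*} (e : α ≃ β) (π : Perm α) :
    e.permCongr π⁻¹ = (e.permCongr π)⁻¹ := map_inv e.permCongrHom π

/-! ### Factorizations of the full cycles -/

/-- The tuples that correspond to the colour preserving non-crossing permutations of a circle. -/
def discFactorizations (k n : ℕ) : Set (Fin k → Perm (Fin n)) :=
  {τ | tupleLength τ + permLength ((tupleProd τ)⁻¹ * finRotate n) = permLength (finRotate n)}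

/-- The two cycles of an annulus as a permutation of a disjoint sum. -/
abbrev sumRotate (p q : ℕ) : Perm (Fin p ⊕ Fin q) := Perm.sumCongr (finRotate p) (finRotate q)

/-- The tuples that correspond to the colour preserving non-crossing permutations of an annulus. -/
def ringFactorizations (k p q : ℕ) : Set (Fin k → Perm (Fin p ⊕ Fin q)) :=
  {τ | (∃ r a b, τ r (Sum.inl a) = Sum.inr b) ∧
    tupleLength τ + permLength ((tupleProd τ)⁻¹ * sumRotate p q) = permLength (sumRotate p q) + 2}

lemma blockPerm_mem_NC_iff {k n : ℕ} (hk : 0 < k) (τ : Fin k → Perm (Fin n)) :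
    (residueEquiv k n).symm.permCongr (blockPerm τ) ∈ NC (k * n) ↔ τ ∈ discFactorizations k n := by
  have h1 : finRotate (k * n) = (residueEquiv k n).symm.permCongr (spiral k (finRotate n)) := by
    rw [← residueEquiv_permCongr hk]; ext x; simp
  rw [mem_NC_iff, h1, ← permCongr_inv, ← permCongr_mul, permLength_permCongr,
    permLength_permCongr, permLength_permCongr]
  exact permLength_blockPerm_spiral (finRotate n) τ hk 0

lemma annulusResidueEquiv_lt_iff {k p q : ℕ} (i : Fin (k * p + k * q)) :
    (i : ℕ) < k * p ↔ (annulusResidueEquiv k p q i).2.isLeft := by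
  refine Fin.addCases (fun i => ?_) (fun i => ?_) i
  · rw [annulusResidueEquiv_castAdd]; simp
  · rw [annulusResidueEquiv_natAdd]; simp

lemma annulusPerm_eq_permCongr_spiral {k p q : ℕ} (hk : 0 < k) :
    annulusPerm (k * p) (k * q) =
      (annulusResidueEquiv k p q).symm.permCongr (spiral k (sumRotate p q)) := by
  rw [← annulusResidueEquiv_permCongr hk]; ext x; simp

lemma blockPerm_mem_SNC_iff {k p q : ℕ} (hk : 0 < k) (τ : Fin k → Perm (Fin p ⊕ Fin q)) :
    (annulusResidueEquiv k p q).symm.permCongr (blockPerm τ) ∈ SNC (k * p) (k * q) ↔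
      τ ∈ ringFactorizations k p q := by
  rw [mem_SNC_iff, annulusPerm_eq_permCongr_spiral hk, ← permCongr_inv, ← permCongr_mul,
    permLength_permCongr, permLength_permCongr, permLength_permCongr,
    permLength_blockPerm_spiral (sumRotate p q) τ hk 2]
  refine and_congr_left fun _ => ?_
  simp only [annulusResidueEquiv_lt_iff, Equiv.permCongr_apply, Equiv.symm_symm,
    Equiv.apply_symm_apply, blockPerm, Equiv.coe_fn_mk]
  rw [(annulusResidueEquiv k p q).exists_congr_left]
  simp only [Equiv.apply_symm_apply, Prod.exists]
  refine exists_congr fun r => ?_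
  constructor
  · rintro ⟨x | x, h1, h2⟩
    · rcases h : τ r (Sum.inl x) with y | y
      · simp [h] at h2
      · exact ⟨x, y, h⟩
    · simp at h1
  · rintro ⟨x, y, h⟩
    exact ⟨Sum.inl x, rfl, by simp [h]⟩

lemma exists_ne_inl_of_tupleProd {k : ℕ} {α β : Type*} [Finite α] [Finite β]
    {τ : Fin k → Perm (α ⊕ β)} {a : α} {b : β} (h : tupleProd τ (Sum.inl a) = Sum.inr b) :
    ∃ r a b, τ r (Sum.inl a) = Sum.inr b := by
  by_contra! hτ
  obtain ⟨σ, ρ, rfl⟩ := exists_sumCongr_of_mapsTo (τ := τ) fun r a => by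
    rcases h : τ r (Sum.inl a) with a' | b
    · exact ⟨a', rfl⟩
    · exact absurd h (hτ r a b)
  rw [tupleProd_sumCongr] at h
  simp at h

lemma exists_tupleProd_ne_inl {α β : Type*} [Finite α] [Finite β] {u : Perm (α ⊕ β)} {a : α} {b : β}
    (h : u.SameCycle (Sum.inl a) (Sum.inr b)) : ∃ a b, u (Sum.inl a) = Sum.inr b := by
  obtain ⟨x, h1, h2⟩ := (exists_sameCycle_iff u fun x => x.isLeft = true).1
    ⟨_, _, rfl, by simp, h⟩
  rcases x with x | x
  · rcases h3 : u (Sum.inl x) with y | y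
    · simp [h3] at h2
    · exact ⟨x, y, h3⟩
  · simp at h1

lemma permLength_le_add {α : Type*} [Finite α] (u γ : Perm α) :
    permLength γ ≤ permLength u + permLength (u⁻¹ * γ) := by
  have := permLength_prod_le [u, u⁻¹ * γ]
  simpa using this

/-- With `u` the product, |γ| ≤ |u| + |u⁻¹γ| ≤ Σ|τ_r| + |u⁻¹γ|. Equality of the ends forces it at
both steps. -/
lemma discFactorizations_eq (k n : ℕ) :
    discFactorizations k n = ⋃ u ∈ (NC n : Set (Perm (Fin n))), geodesics k u := by
  ext τ
  simp only [Set.mem_iUnion, Finset.mem_coe, mem_NC_iff, discFactorizations, geodesics,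
    Set.mem_ofPred_eq, exists_prop]
  constructor
  · intro h
    have h1 := permLength_tupleProd_le (τ := τ)
    have h2 := permLength_le_add (tupleProd τ) (finRotate n)
    exact ⟨tupleProd τ, by omega, rfl, by omega⟩
  · rintro ⟨u, h1, rfl, h2⟩
    omega

lemma finsum_mem_discFactorizations {k : ℕ} (c : Fin k → ℕ → ℂ) (n : ℕ) :
    ∑ᶠ τ ∈ discFactorizations k n, tupleWeight c τ = ∑ u ∈ NC n, geodesicSum c u := by
  rw [discFactorizations_eq, finsum_mem_biUnion ?_ (Set.toFinite _) fun _ _ => Set.toFinite _,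
    finsum_mem_coe_finset]
  · rfl
  · intro u _ v _ huv
    exact Set.disjoint_left.2 fun τ h1 h2 => huv (h1.1.symm.trans h2.1)

lemma mem_SNC_iff_sum {p q : ℕ} {u : Perm (Fin p ⊕ Fin q)} :
    finSumFinEquiv.permCongr u ∈ SNC p q ↔ (∃ a b, u (Sum.inl a) = Sum.inr b) ∧
      permLength u + permLength (u⁻¹ * sumRotate p q) = permLength (sumRotate p q) + 2 := by
  rw [mem_SNC_iff, annulusPerm, ← permCongr_inv, ← permCongr_mul, permLength_permCongr,
    permLength_permCongr, permLength_permCongr]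
  refine and_congr_left fun _ => ?_
  rw [(finSumFinEquiv (m := p) (n := q)).symm.exists_congr_left]
  simp only [Equiv.symm_symm, Equiv.permCongr_apply, Equiv.symm_apply_apply]
  constructor
  · rintro ⟨x | x, h1, h2⟩
    · rcases h : u (Sum.inl x) with y | y
      · simp [h] at h2
      · exact ⟨x, y, h⟩
    · simp at h1
  · rintro ⟨x, y, h⟩
    exact ⟨Sum.inl x, by simp, by simp [h]⟩

/-- Here `u` is a factor of the minimal factorization `u`, `u⁻¹ * Perm.sumCongr γ δ`, so it stays
within the cycles of `γ` and `δ`. -/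
lemma exists_sumCongr_of_geodesic {α β : Type*} [Finite α] [Finite β] {u : Perm (α ⊕ β)}
    {γ : Perm α} {δ : Perm β} (h : permLength u + permLength (u⁻¹ * Perm.sumCongr γ δ) =
      permLength (Perm.sumCongr γ δ)) :
    ∃ v w, u = Perm.sumCongr v w ∧
      permLength v + permLength (v⁻¹ * γ) = permLength γ ∧
      permLength w + permLength (w⁻¹ * δ) = permLength δ := by
  have h1 : ∀ x, (Perm.sumCongr γ δ).SameCycle x (u x) := fun x => by
    have := sameCycle_prod_of_geodesic (l := [u, u⁻¹ * Perm.sumCongr γ δ]) (by simpa using h)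
      (τ := u) (by simp) x
    simpa using this
  obtain ⟨v, w, hu⟩ := exists_sumCongr_of_mapsTo (k := 1) (τ := fun _ => u) fun _ a => by
    have h2 := h1 (Sum.inl a)
    rcases h3 : u (Sum.inl a) with a' | b
    · exact ⟨a', rfl⟩
    · rw [h3] at h2; exact absurd h2 (by simp)
  have hu' : u = Perm.sumCongr (v 0) (w 0) := congrFun hu 0
  refine ⟨v 0, w 0, hu', ?_⟩
  rw [hu', Perm.sumCongr_inv, Perm.sumCongr_mul, permLength_sumCongr, permLength_sumCongr,
    permLength_sumCongr] at h
  have := permLength_le_add (v 0) γ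
  have := permLength_le_add (w 0) δ
  omega

/-- The total excess 2 is shared between |u| ≤ Σ|τ_r| and |γ| ≤ |u| + |u⁻¹γ|, where `u` is the
product. By parity one of the two inequalities takes all of it. -/
lemma ringFactorizations_eq (k p q : ℕ) :
    ringFactorizations k p q =
      (⋃ π ∈ (SNC p q : Set (Perm (Fin (p + q)))),
        geodesics k (finSumFinEquiv.symm.permCongr π)) ∪
      ⋃ u ∈ ((NC p ×ˢ NC q : Finset _) : Set (Perm (Fin p) × Perm (Fin q))),
        annularFactorizations k u.1 u.2 := by
  ext τ
  have hsymm : ∀ u : Perm (Fin p ⊕ Fin q),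
      finSumFinEquiv.symm.permCongr (finSumFinEquiv.permCongr u) = u := fun u => by ext x; simp
  have hsymm' : ∀ π : Perm (Fin (p + q)),
      finSumFinEquiv.permCongr (finSumFinEquiv.symm.permCongr π) = π := fun u => by ext x; simp
  simp only [Set.mem_union, Set.mem_iUnion, Finset.mem_coe, exists_prop]
  constructor
  · rintro ⟨⟨r, a, b, h1⟩, h2⟩
    have h3 := permLength_tupleProd_le (τ := τ)
    have h4 := permLength_le_add (tupleProd τ) (sumRotate p q)
    have h5 := permLength_tupleProd_mod_two (τ := τ)
    rcases Nat.lt_or_ge (permLength (tupleProd τ)) (tupleLength τ) with h6 | h6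
    -- The factorization of `u` has excess 2, so `u` lies on a geodesic to the two full cycles and
    -- splits.
    · right
      obtain ⟨v, w, h7, h8, h9⟩ := exists_sumCongr_of_geodesic (u := tupleProd τ)
        (γ := finRotate p) (δ := finRotate q) (by
          change _ + permLength (_ * sumRotate p q) = permLength (sumRotate p q)
          omega)
      refine ⟨(v, w), Finset.mem_product.2 ⟨mem_NC_iff.2 h8, mem_NC_iff.2 h9⟩, h7, ?_, r, a, b, h1⟩
      rw [← permLength_sumCongr, ← h7]
      omega
    -- The factorization is minimal, so its crossing factor moves along a cycle of `u`, which
    -- therefore meets both circles.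
    · left
      refine ⟨finSumFinEquiv.permCongr (tupleProd τ), mem_SNC_iff_sum.2 ⟨?_, by omega⟩, ?_⟩
      · have h7 := sameCycle_tupleProd (τ := τ) (by omega) r (Sum.inl a)
        rw [h1] at h7
        exact exists_tupleProd_ne_inl h7
      · rw [hsymm]
        exact ⟨rfl, by omega⟩
  · rintro (⟨π, h1, h2, h3⟩ | ⟨⟨v, w⟩, h1, h2, h3, h4⟩)
    · rw [← hsymm' π, ← h2] at h1
      rw [← h2] at h3
      obtain ⟨⟨a, b, h4⟩, h5⟩ := mem_SNC_iff_sum.1 h1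
      exact ⟨exists_ne_inl_of_tupleProd h4, by omega⟩
    · refine ⟨h4, ?_⟩
      obtain ⟨h5, h6⟩ := Finset.mem_product.1 h1
      rw [mem_NC_iff] at h5 h6
      dsimp only at h2 h3 h5 h6
      rw [h2, h3, Perm.sumCongr_inv, Perm.sumCongr_mul, permLength_sumCongr, permLength_sumCongr]
      omega

lemma finsum_mem_ringFactorizations {k : ℕ} (c : Fin k → ℕ → ℂ) (p q : ℕ) :
    ∑ᶠ τ ∈ ringFactorizations k p q, tupleWeight c τ =
      ∑ π ∈ SNC p q, geodesicSum c π + ∑ u ∈ NC p ×ˢ NC q, annularSum c u.1 u.2 := by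
  rw [ringFactorizations_eq, finsum_mem_union ?_ (Set.toFinite _) (Set.toFinite _),
    finsum_mem_biUnion ?_ (Set.toFinite _) fun _ _ => Set.toFinite _,
    finsum_mem_biUnion ?_ (Set.toFinite _) fun _ _ => Set.toFinite _,
    finsum_mem_coe_finset, finsum_mem_coe_finset]
  · congr 1
    refine Finset.sum_congr rfl fun π _ => ?_
    exact geodesicSum_permCongr c finSumFinEquiv.symm π
  · rintro ⟨u, v⟩ _ ⟨u', v'⟩ _ huv
    refine Set.disjoint_left.2 fun τ h1 h2 => huv ?_
    exact Perm.sumCongrHom_injective (α := Fin p) (β := Fin q) (h1.1.symm.trans h2.1)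
  · intro u _ v _ huv
    refine Set.disjoint_left.2 fun τ h1 h2 => huv ?_
    exact finSumFinEquiv.symm.permCongr.injective (h1.1.symm.trans h2.1)
  -- One union has excess 0 over the length of the product, the other excess 2.
  · refine Set.disjoint_left.2 fun τ h1 h2 => ?_
    simp only [Set.mem_iUnion, exists_prop] at h1 h2
    obtain ⟨π, -, h3, h4⟩ := h1
    obtain ⟨u, -, h5, h6, -⟩ := h2
    rw [← h3, h5, permLength_sumCongr] at h4
    omega

/-! ### The Kreweras complements of alternating permutations -/

section Alternating
variable {k p q : ℕ} (hk : 0 < k) (τ : Fin k → Perm (Fin p ⊕ Fin q))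
include hk

lemma annulusPerm_mul_blockPerm_inv :
    annulusPerm (k * p) (k * q) * ((annulusResidueEquiv k p q).symm.permCongr (blockPerm τ))⁻¹ =
      (annulusResidueEquiv k p q).symm.permCongr (spiral k (sumRotate p q) * (blockPerm τ)⁻¹) := by
  rw [annulusPerm_eq_permCongr_spiral hk, permCongr_mul, permCongr_inv]

lemma isAlternating_annulusPerm_mul_inv : IsAlternating k (annulusPerm (k * p) (k * q) *
    ((annulusResidueEquiv k p q).symm.permCongr (blockPerm τ))⁻¹) := by
  intro i
  rw [annulusPerm_mul_blockPerm_inv hk]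
  set σ := (annulusResidueEquiv k p q).symm.permCongr (spiral k (sumRotate p q) * (blockPerm τ)⁻¹)
    with hσ
  have h1 : ((annulusResidueEquiv k p q (σ i)).1 : ℕ) ≡
      ((annulusResidueEquiv k p q i).1 : ℕ) + 1 [MOD k] := by
    rw [hσ, Equiv.permCongr_apply, Equiv.apply_symm_apply, spiral_mul_apply]
    exact finRotate_val_modEq _
  rw [annulusResidueEquiv_fst, annulusResidueEquiv_fst] at h1
  exact (Nat.mod_modEq _ _).symm.trans (h1.trans ((Nat.mod_modEq _ _).add_right 1))

lemma isEqual_annulusPerm_mul_inv_iff : IsEqual k (annulusPerm (k * p) (k * q) *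
    ((annulusResidueEquiv k p q).symm.permCongr (blockPerm τ))⁻¹) ↔
      tupleProd τ = sumRotate p q := by
  rw [annulusPerm_mul_blockPerm_inv hk, ← minimalPeriod_spiral_eq_iff (sumRotate p q) τ hk]
  rw [IsEqual, ← (annulusResidueEquiv k p q).symm.forall_congr_right]
  simp only [cycleSize, minimalPeriod_permCongr]

omit hk in
lemma mem_annularFactorizations_iff : τ ∈ annularFactorizations k (finRotate p) (finRotate q) ↔
    τ ∈ ringFactorizations k p q ∧ tupleProd τ = sumRotate p q := by
  constructor
  · rintro ⟨h1, h2, h3⟩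
    refine ⟨⟨h3, ?_⟩, h1⟩
    rw [h1, h2, inv_mul_cancel, permLength_one, permLength_sumCongr]
  · rintro ⟨⟨h1, h2⟩, h3⟩
    rw [h3, inv_mul_cancel, permLength_one, permLength_sumCongr] at h2
    exact ⟨h3, h2, h1⟩

end Alternating

/-! ### Moments and cumulants of the product -/

variable {A : Type*} [Ring A] [Algebra ℂ A]

lemma finRotate_mem_NC (n : ℕ) : finRotate n ∈ NC n := by
  rw [mem_NC_iff, inv_mul_cancel, permLength_one, add_zero]

lemma finRotate_iterate_zero {n : ℕ} (j : ℕ) (hj : j < n + 1) :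
    (finRotate (n + 1))^[j] 0 = ⟨j, hj⟩ := by
  induction j with
  | zero => rfl
  | succ j ih =>
    rw [Function.iterate_succ_apply', ih (by omega)]
    refine Fin.ext ?_
    rw [finRotate_val, if_neg (by simp; omega)]

lemma sameCycle_finRotate {n : ℕ} (i j : Fin n) : (finRotate n).SameCycle i j := by
  cases n with
  | zero => exact i.elim0
  | succ n =>
    have h : ∀ l : Fin (n + 1), (finRotate (n + 1)).SameCycle 0 l := fun l =>
      sameCycle_iff_iterate.2 ⟨l, finRotate_iterate_zero l l.2⟩
    exact (h i).symm.trans (h j)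

lemma cycleSize_finRotate {n : ℕ} (i : Fin n) : cycleSize (finRotate n) i = n := by
  obtain ⟨e, -⟩ := exists_equiv_finRotate (finRotate n) i (sameCycle_finRotate i)
  have h : Function.minimalPeriod (finRotate n) i = n := by simpa using Fintype.card_congr e
  exact h

lemma cycleReps_finRotate (n : ℕ) : cycleReps (finRotate (n + 1)) = {0} := by
  ext i
  simp only [cycleReps, Finset.mem_filter, Finset.mem_univ, true_and, Finset.mem_singleton]
  constructor
  · intro h
    exact Fin.le_zero_iff.1 (h 0 (sameCycle_finRotate _ _))
  · rintro rfl j _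
    exact Fin.zero_le j

lemma cumulant_congr (S : ProbSpace A) {m n : ℕ} (h : m = n) {x : Fin m → A} {y : Fin n → A}
    (hxy : ∀ i, x i = y (Fin.cast h i)) : cumulant S m x = cumulant S n y := by
  subst h
  exact congrArg _ (funext hxy)

lemma permCumulant_finRotate (S : ProbSpace A) {n : ℕ} (hn : 0 < n) (x : Fin n → A) :
    permCumulant S (finRotate n) x = cumulant S n x := by
  obtain ⟨m, rfl⟩ : ∃ m, n = m + 1 := ⟨n - 1, by omega⟩
  rw [permCumulant, cycleReps_finRotate, Finset.prod_singleton]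
  refine cumulant_congr S (cycleSize_finRotate _) fun i => ?_
  rw [alongCycle, ← Perm.iterate_eq_pow, finRotate_iterate_zero _ (i.2.trans_eq (cycleSize_finRotate _))]
  rfl

/-- The moment-cumulant formula. -/
lemma phi_eq_sum (S : ProbSpace A) {n : ℕ} (hn : 0 < n) (x : Fin n → A) :
    S.phi (List.ofFn x).prod = ∑ π ∈ NC n, permCumulant S π x := by
  classical
  rw [← Finset.add_sum_erase _ _ (finRotate_mem_NC n), permCumulant_finRotate S hn, cumulant,
    Finset.sum_attach ((NC n).erase (finRotate n)) fun π =>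
      ∏ i ∈ cycleReps π, cumulant S (cycleSize π i) (alongCycle π x i)]
  exact (sub_add_cancel _ _).symm

lemma prod_ofFn_periodic {A : Type*} [Ring A] {k : ℕ} (hk : 0 < k) (a : Fin k → A) (n : ℕ) :
    (List.ofFn (periodic hk a (k * n))).prod = (List.ofFn a).prod ^ n := by
  rw [List.ofFn_mul', List.prod_flatten, List.map_ofFn, ← List.prod_replicate, ← List.ofFn_const]
  congr 2
  funext i
  simp only [Function.comp]
  congr 2
  funext j
  simp only [periodic]
  congr 1
  exact Fin.ext (by simp [Nat.mod_eq_of_lt j.2])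

lemma prod_ofFn_const {A : Type*} [Ring A] (x : A) (n : ℕ) : (List.ofFn fun _ : Fin n => x).prod = x ^ n := by
  simp [List.ofFn_const]

lemma append_periodic {A : Type*} {k : ℕ} (hk : 0 < k) (a : Fin k → A) (p q : ℕ) :
    Fin.append (periodic hk a (k * p)) (periodic hk a (k * q)) =
      periodic hk a (k * p + k * q) := by
  funext i
  refine Fin.addCases (fun i => ?_) (fun i => ?_) i
  · rw [Fin.append_left]; rfl
  · rw [Fin.append_right]
    simp [periodic]

lemma append_const {A : Type*} (x : A) (p q : ℕ) :
    Fin.append (fun _ : Fin p => x) (fun _ : Fin q => x) = fun _ => x := by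
  funext i
  refine Fin.addCases (fun i => ?_) (fun i => ?_) i
  · rw [Fin.append_left]
  · rw [Fin.append_right]

/-! ### Comparison with the moment-cumulant recursions -/

section Main
variable {S : ProbSpace A} {k : ℕ} {a : Fin k → A}

lemma geodesicSum_eq_permCumulant {c : Fin k → ℕ → ℂ} {x : A} {n : ℕ} {π : Perm (Fin n)}
    (h : ∀ i, geodesicSum c (finRotate (cycleSize π i)) = selfCumulant S x (cycleSize π i)) :
    geodesicSum c π = permCumulant S π fun _ => x := by
  rw [geodesicSum_eq_prod c (isCycleTransversal_cycleReps π), permCumulant_const,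
    Finset.prod_coe_sort (cycleReps π) fun i =>
      geodesicSum c (finRotate (Function.minimalPeriod π i))]
  exact Finset.prod_congr rfl fun i _ => h i

/-- The free cumulants of a product of free elements. -/
theorem geodesicSum_finRotate (hk : 0 < k) (hfree : ElementsSecondOrderFree S a) {n : ℕ}
    (hn : 0 < n) : geodesicSum (fun r => selfCumulant S (a r)) (finRotate n) =
      selfCumulant S (List.ofFn a).prod n := by
  classical
  induction n using Nat.strong_induction_on with
  | _ n ih =>
    set c : Fin k → ℕ → ℂ := fun r => selfCumulant S (a r)
    have h1 := phi_eq_sum S hn fun _ => (List.ofFn a).prod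
    have h2 : S.phi (List.ofFn (periodic hk a (k * n))).prod = ∑ u ∈ NC n, geodesicSum c u := by
      rw [phi_eq_sum S (Nat.mul_pos hk hn), ← finsum_mem_discFactorizations,
        ← sum_permCumulant_eq hfree (residueEquiv k n) (blockPerm_mem_NC_iff hk)]
      refine Finset.sum_congr rfl fun π _ => congrArg _ (funext fun i => ?_)
      exact congrArg a (Fin.ext (residueEquiv_fst i).symm)
    rw [prod_ofFn_periodic] at h2
    rw [prod_ofFn_const, h2, ← Finset.add_sum_erase _ _ (finRotate_mem_NC n),
      ← Finset.add_sum_erase _ (fun π => permCumulant S π _) (finRotate_mem_NC n),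
      permCumulant_finRotate S hn] at h1
    -- Every other non-crossing permutation has only cycles shorter than `n`, so all terms but that
    -- of the full cycle agree by induction.
    have h3 : ∀ π ∈ (NC n).erase (finRotate n), geodesicSum c π =
        permCumulant S π fun _ => (List.ofFn a).prod := fun π hπ =>
      geodesicSum_eq_permCumulant fun i => ih _ (cycleSize_lt (Finset.mem_of_mem_erase hπ)
        (Finset.ne_of_mem_erase hπ) i) (cycleSize_pos π i)
    rw [Finset.sum_congr rfl h3] at h1
    exact add_right_cancel h1

/-- Either two indices differ and freeness applies, or all entries are the same `a i` and the
hypothesis `hzero` applies. -/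
lemma cumulant₂_eq_zero (hfree : ElementsSecondOrderFree S a)
    (hzero : ∀ (i : Fin k) (p q : ℕ), 0 < p → 0 < q →
      cumulant₂ S p q (fun _ => a i) (fun _ => a i) = 0)
    {m n : ℕ} (hm : 0 < m) (hn : 0 < n) (c : Fin m → Fin k) (d : Fin n → Fin k) :
    cumulant₂ S m n (fun i => a (c i)) (fun j => a (d j)) = 0 := by
  by_cases h : ∃ r s, Sum.elim c d r ≠ Sum.elim c d s
  · refine hfree.2 m n _ _ (Sum.elim c d) hm hn ?_ h
    rintro (i | j)
    · exact Algebra.self_mem_adjoin_singleton ℂ (a (c i))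
    · exact Algebra.self_mem_adjoin_singleton ℂ (a (d j))
  · push Not at h
    have hc : ∀ i, c i = c ⟨0, hm⟩ := fun i => h (Sum.inl i) (Sum.inl _)
    have hd : ∀ j, d j = c ⟨0, hm⟩ := fun j => h (Sum.inr j) (Sum.inl _)
    simp only [hc, hd]
    exact hzero _ m n hm hn

/-- The second order moments of the product, in terms of the permutations of the annulus. -/
theorem phi2_eq_sum_SNC (hk : 0 < k) (hfree : ElementsSecondOrderFree S a)
    (hzero : ∀ (i : Fin k) (p q : ℕ), 0 < p → 0 < q →
      cumulant₂ S p q (fun _ => a i) (fun _ => a i) = 0)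
    {p q : ℕ} (hp : 0 < p) (hq : 0 < q) :
    S.phi2 ((List.ofFn a).prod ^ p) ((List.ofFn a).prod ^ q) =
      ∑ π ∈ SNC (k * p) (k * q), permCumulant S π (periodic hk a (k * p + k * q)) := by
  -- Unfolding this vanishing cumulant gives the moment; each partitioned term contains a second
  -- order cumulant in the `a i` and vanishes as well.
  have h1 := cumulant₂_eq_zero hfree hzero (Nat.mul_pos hk hp) (Nat.mul_pos hk hq)
    (fun i => ⟨i % k, Nat.mod_lt _ hk⟩) (fun i => ⟨i % k, Nat.mod_lt _ hk⟩)
  change cumulant₂ S _ _ (periodic hk a (k * p)) (periodic hk a (k * q)) = 0 at h1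
  rw [cumulant₂, prod_ofFn_periodic, prod_ofFn_periodic, append_periodic, sub_sub, sub_eq_zero] at h1
  refine h1.trans (add_eq_left.2 (Finset.sum_eq_zero fun t _ => ?_))
  have h2 := cumulant₂_eq_zero hfree hzero (cycleSize_pos t.1.1.1 t.1.2.1)
    (cycleSize_pos t.1.1.2 t.1.2.2)
    (fun j => ⟨((t.1.1.1 ^ (j : ℕ)) t.1.2.1 : Fin _) % k, Nat.mod_lt _ hk⟩)
    (fun j => ⟨((t.1.1.2 ^ (j : ℕ)) t.1.2.2 : Fin _) % k, Nat.mod_lt _ hk⟩)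
  change cumulant₂ S _ _ (alongCycle t.1.1.1 (periodic hk a (k * p)) t.1.2.1)
    (alongCycle t.1.1.2 (periodic hk a (k * q)) t.1.2.2) = 0 at h2
  rw [h2, zero_mul, zero_mul]

lemma sum_permCumulant_annulus (hk : 0 < k) (hfree : ElementsSecondOrderFree S a) {p q : ℕ}
    {s : Finset (Perm (Fin (k * p + k * q)))} {T : Set (Fin k → Perm (Fin p ⊕ Fin q))}
    (h : ∀ τ, (annulusResidueEquiv k p q).symm.permCongr (blockPerm τ) ∈ s ↔ τ ∈ T) :
    ∑ π ∈ s, permCumulant S π (periodic hk a (k * p + k * q)) =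
      ∑ᶠ τ ∈ T, tupleWeight (fun r => selfCumulant S (a r)) τ := by
  rw [← sum_permCumulant_eq hfree (annulusResidueEquiv k p q) h]
  refine Finset.sum_congr rfl fun π _ => congrArg _ (funext fun i => ?_)
  exact congrArg a (Fin.ext (annulusResidueEquiv_fst i).symm)

/-- `Kr` is a bijection of S_NC onto itself with inverse ρ ↦ γρ⁻¹. After substituting ρ = Kr(π),
only the colour preserving ρ contribute, so `P` needs to be known only at their preimages. -/
lemma sum_permCumulant_Kr (hk : 0 < k) (hfree : ElementsSecondOrderFree S a) {p q : ℕ}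
    {P : Perm (Fin (k * p + k * q)) → Prop} [DecidablePred P]
    {T : Set (Fin k → Perm (Fin p ⊕ Fin q))}
    (h : ∀ τ, τ ∈ ringFactorizations k p q ∧ P (annulusPerm (k * p) (k * q) *
      ((annulusResidueEquiv k p q).symm.permCongr (blockPerm τ))⁻¹) ↔ τ ∈ T) :
    ∑ π ∈ (SNC (k * p) (k * q)).filter P,
        permCumulant S (Kr π) (periodic hk a (k * p + k * q)) =
      ∑ᶠ τ ∈ T, tupleWeight (fun r => selfCumulant S (a r)) τ := by
  classical
  rw [← Finset.sum_image (f := fun π => permCumulant S π (periodic hk a (k * p + k * q)))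
    (Kr_injective.injOn), sum_permCumulant_annulus hk hfree]
  intro τ
  rw [← h, ← blockPerm_mem_SNC_iff hk, ← annulusPerm_mul_inv_mem_SNC_iff]
  simp only [Finset.mem_image, Finset.mem_filter, Kr_eq_iff]
  simp

/-- The second order cumulants of a product of second order free elements. -/
theorem annularSum_finRotate (hk : 0 < k) (hfree : ElementsSecondOrderFree S a)
    (hzero : ∀ (i : Fin k) (p q : ℕ), 0 < p → 0 < q →
      cumulant₂ S p q (fun _ => a i) (fun _ => a i) = 0)
    {p q : ℕ} (hp : 0 < p) (hq : 0 < q) :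
    cumulant₂ S p q (fun _ => (List.ofFn a).prod) (fun _ => (List.ofFn a).prod) =
      annularSum (fun r => selfCumulant S (a r)) (finRotate p) (finRotate q) := by
  classical
  induction hN : p + q using Nat.strong_induction_on generalizing p q with
  | _ N ih =>
    subst hN
    set x := (List.ofFn a).prod with hx
    set c : Fin k → ℕ → ℂ := fun r => selfCumulant S (a r) with hc
    have h1 : S.phi2 (x ^ p) (x ^ q) = ∑ π ∈ SNC p q, permCumulant S π (fun _ => x) +
        ∑ u ∈ NC p ×ˢ NC q, annularSum c u.1 u.2 := by
      rw [phi2_eq_sum_SNC hk hfree hzero hp hq,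
        sum_permCumulant_annulus hk hfree (blockPerm_mem_SNC_iff hk), finsum_mem_ringFactorizations]
      congr 1
      exact Finset.sum_congr rfl fun π _ => geodesicSum_eq_permCumulant fun i =>
        geodesicSum_finRotate hk hfree (cycleSize_pos π i)
    -- The S_NC sums cancel and the pair of full cycles gives the claimed value. It remains to match
    -- the other pairs with the lower terms of the recursion.
    rw [cumulant₂, prod_ofFn_const, prod_ofFn_const, append_const, h1, add_sub_cancel_left,
      ← Finset.add_sum_erase (NC p ×ˢ NC q) _
        (Finset.mem_product.2 ⟨finRotate_mem_NC p, finRotate_mem_NC q⟩ :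
          (finRotate p, finRotate q) ∈ NC p ×ˢ NC q), add_sub_assoc, add_eq_left, sub_eq_zero]
    refine Eq.trans ?_ (Finset.sum_attach ((PSNC' p q).filter fun t => t.1 ≠ (finRotate p, finRotate q)) fun t =>
      cumulant₂ S (cycleSize t.1.1 t.2.1) (cycleSize t.1.2 t.2.2)
          (fun _ => x) (fun _ => x) *
        (∏ i ∈ (cycleReps t.1.1).erase t.2.1, selfCumulant S x (cycleSize t.1.1 i)) *
        (∏ j ∈ (cycleReps t.1.2).erase t.2.2, selfCumulant S x (cycleSize t.1.2 j))).symm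
    -- Partitioned permutations are grouped by the underlying pair; the inner sum runs over the
    -- choice of the two joined cycles.
    rw [Finset.sum_finset_product _ ((NC p ×ˢ NC q).erase (finRotate p, finRotate q))
      (fun u => cycleReps u.1 ×ˢ cycleReps u.2)]
    swap
    · rintro ⟨⟨u, v⟩, i, j⟩
      simp only [PSNC', Finset.mem_filter, Finset.mem_univ, true_and, Finset.mem_erase,
        Finset.mem_product]
      tauto
    refine Finset.sum_congr rfl fun u hu => ?_
    obtain ⟨hne, hu⟩ := Finset.mem_erase.1 hu
    obtain ⟨hu1, hu2⟩ := Finset.mem_product.1 hu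
    rw [annularSum_eq_sum c (isCycleTransversal_cycleReps u.1) (isCycleTransversal_cycleReps u.2)]
    refine Finset.sum_nbij (fun t => ((t.1 : Fin p), (t.2 : Fin q)))
      (fun t _ => Finset.mem_product.2 ⟨t.1.2, t.2.2⟩)
      (Subtype.val_injective.prodMap Subtype.val_injective).injOn (fun t ht => ?_) ?_
    · obtain ⟨h1, h2⟩ := Finset.mem_product.1 ht
      exact ⟨(⟨t.1, h1⟩, ⟨t.2, h2⟩), by simp, rfl⟩
    rintro ⟨⟨i, hi⟩, ⟨j, hj⟩⟩ -
    have e : ∀ {n : ℕ} (π : Perm (Fin n)) (i : {i // i ∈ cycleReps π}),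
        ∏ l ∈ Finset.univ.erase i, geodesicSum c (finRotate (Function.minimalPeriod π l)) =
          ∏ l ∈ (cycleReps π).erase i, selfCumulant S x (cycleSize π l) := by
      intro n π i
      refine Finset.prod_nbij (fun l => (l : Fin n)) (fun l hl => ?_) Subtype.val_injective.injOn
        (fun l hl => ?_) fun l _ => geodesicSum_finRotate hk hfree (cycleSize_pos π l)
      · exact Finset.mem_erase.2 ⟨fun h => (Finset.mem_erase.1 hl).1 (Subtype.ext h), l.2⟩
      · obtain ⟨h1, h2⟩ := Finset.mem_erase.1 hl
        exact ⟨⟨l, h2⟩, by simpa [Subtype.ext_iff] using h1, rfl⟩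
    -- The pair is not the pair of full cycles, so the joined cycles miss a point and induction
    -- applies.
    have h2 : cycleSize u.1 i + cycleSize u.2 j < p + q :=
      add_cycleSize_lt (t := (u, (i, j)))
        (by simp only [PSNC', Finset.mem_filter, Finset.mem_univ, true_and]
            exact ⟨hu1, hu2, hi, hj⟩) hne
    have h3 := ih _ h2 (cycleSize_pos u.1 i) (cycleSize_pos u.2 j) rfl
    dsimp only
    rw [e, e]
    congr 2
    exact h3.symm

end Main

end SecondOrder

open SecondOrder in
open Classical in
theorem theorem3p7 {A : Type*} [Ring A] [Algebra ℂ A] (S : ProbSpace A)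
    (k : ℕ) (hk : 0 < k) (a : Fin k → A)
    (hfree : ElementsSecondOrderFree S a)
    (hzero : ∀ (i : Fin k) (p q : ℕ), 0 < p → 0 < q →
      cumulant₂ S p q (fun _ => a i) (fun _ => a i) = 0)
    (p q : ℕ) (hp : 0 < p) (hq : 0 < q) :
    S.phi2 ((List.ofFn a).prod ^ p) ((List.ofFn a).prod ^ q) =
        ∑ π ∈ (SNC (k * p) (k * q)).filter fun π => IsAlternating k π,
          permCumulant S (Kr π) (periodic hk a (k * p + k * q)) ∧
      cumulant₂ S p q (fun _ => (List.ofFn a).prod) (fun _ => (List.ofFn a).prod) =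
        ∑ π ∈ (SNC (k * p) (k * q)).filter fun π => IsAlternating k π ∧ IsEqual k π,
          permCumulant S (Kr π) (periodic hk a (k * p + k * q)) := by
  constructor
  -- Both sides become the sum over `ringFactorizations`, one directly and one through `Kr`; the
  -- alternating condition is then automatic.
  · rw [phi2_eq_sum_SNC hk hfree hzero hp hq,
      sum_permCumulant_annulus hk hfree (blockPerm_mem_SNC_iff hk),
      sum_permCumulant_Kr hk hfree (T := ringFactorizations k p q)]
    exact fun τ => and_iff_left (isAlternating_annulusPerm_mul_inv hk τ)
  -- The `k`-equal condition selects the tuples whose product is the pair of full cycles, which are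
  -- the annular factorizations.
  · rw [annularSum_finRotate hk hfree hzero hp hq, annularSum,
      sum_permCumulant_Kr hk hfree (T := annularFactorizations k (finRotate p) (finRotate q))]
    intro τ
    rw [mem_annularFactorizations_iff, isEqual_annulusPerm_mul_inv_iff hk]
    exact and_congr_right fun _ => and_iff_right (isAlternating_annulusPerm_mul_inv hk τ)
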